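/- Let $Q,A,S$ be integers with $1\le A\le S$ and $A\le Q$, let $0<\alpha<1$, and let $P_0=0<P_1<\dots<P_S$ be convex in $s$. A buffer holds $q[n]\in\{0,\dots,Q\}$ packets at the beginning of timeslot $n=1,2,\dots$; in this timeslot $s[n]\in\{0,\dots,S\}$ packets are transmitted, where $0\le q[n]-s[n]\le Q-A$, at the cost of power $P_{s[n]}$, and then $q[n+1]=q[n]-s[n]+A\,a[n]$, where the $a[n]$ are independent and equal to $1$ with probability $\alpha$ and to $0$ with probability $1-\alpha$. A policy $\gamma$ chooses $s[n]$ at random, with a distribution that depends on $q[1],s[1],\dots,q[n-1],s[n-1],q[n]$ and charges only transmissions allowed in state $q[n]$. For the initial state $q[1]=q_0$ its average power and average delay are $$P_\gamma=\limsup_{N\to\infty}\frac1N\,\mathrm E^\gamma_{q_0}\Big\{\sum_{n=1}^N P_{s[n]}\Big\},\qquad D_\gamma=\limsup_{N\to\infty}\frac1{\alpha A}\cdot\frac1N\,\mathrm E^\gamma_{q_0}\Big\{\sum_{n=1}^N q[n]\Big\}.$$ A policy is stationary if it transmits $s$ packets with a probability $f_{q,s}$ that depends only on the current state $q$. Theorem.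 Let $P_{\mathrm{th}}$ be a real number such that $P_\gamma\le P_{\mathrm{th}}$ for at least one policy $\gamma$ and one initial state. Then there is a stationary policy $\boldsymbol F=(f_{q,s})$ with the following properties. (a) There are thresholds $q(0)\le q(1)\le\dots\le q(S)$ in $\{0,\dots,Q\}$ and an index $s^*\in\{0,\dots,S\}$ such that, with $q(-1)=-1$ and $f_{q,S+1}=0$: $f_{q,s}=1$ if $s\ne s^*$ and $q(s-1)<q\le q(s)$; $f_{q,s^*}=1$ if $q(s^*-1)<q<q(s^*)$; $f_{q(s^*),s^*}+f_{q(s^*),s^*+1}=1$; and $f_{q,s}=0$ in all other cases. So $\boldsymbol F$ is deterministic except possibly in the single state $q(s^*)$, where it randomizes between transmitting $s^*$ and $s^*+1$ packets. (b) The limits that define the average power and the average delay of $\boldsymbol F$ exist and do not depend on the initial state. (c) For every initial state, $P_{\boldsymbol F}\le P_{\mathrm{th}}$, and $D_{\boldsymbol F}\le D_\gamma$ for every policy $\gamma$ with $P_\gamma\le P_{\mathrm{th}}$. -/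

import Mathlib

open Filter Topology

namespace BufferedScheduling

/-- A buffer of capacity `Q` fed by a Bernoulli arrival process: at the end of each timeslot `A`
packets arrive with probability `α`, and none with probability `1 - α`. At most `S` packets are
transmitted per timeslot; transmitting `s` packets costs power `P s` (only `s ≤ S` matters). -/
structure Model where
  Q : ℕ
  A : ℕ
  S : ℕ
  α : ℝ
  P : ℕ → ℝ
  A_pos : 1 ≤ A
  A_le_S : A ≤ S
  A_le_Q : A ≤ Q
  α_pos : 0 < α
  α_lt_one : α < 1
  P_zero : P 0 = 0
  P_strictly_increasing : ∀ s, s < S → P s < P (s + 1)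
  P_convex : ∀ s, s + 2 ≤ S → P (s + 1) - P s ≤ P (s + 2) - P (s + 1)

namespace Model

/-- Queue lengths `0, …, Q`. -/
abbrev State (M : Model) : Type := Fin (M.Q + 1)

/-- Numbers of transmitted packets `0, …, S`. -/
abbrev Action (M : Model) : Type := Fin (M.S + 1)

/-- No underflow and no overflow: `0 ≤ q - s ≤ Q - A`. -/
def Feasible (M : Model) (q : M.State) (s : M.Action) : Prop :=
  s.val ≤ q.val ∧ q.val + M.A ≤ M.Q + s.val

/-- The probability that the next queue length is `j`, given queue length `q` and `s`
transmitted packets: `α` if `j = q - s + A`, `1 - α` if `j = q - s`, and `0` otherwise. -/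
noncomputable def transProb (M : Model) (q : M.State) (s : M.Action) (j : M.State) : ℝ :=
  if j.val + s.val = q.val + M.A then M.α
  else if j.val + s.val = q.val then 1 - M.α
  else 0

/-- The (queue length, action) pairs of the first `n` timeslots. -/
abbrev History (M : Model) (n : ℕ) : Type := Fin n → M.State × M.Action

/-- A history-dependent randomized feasible policy: `rule n h q s` is the probability of
transmitting `s` packets in timeslot `n + 1`, when the first `n` timeslots went as recorded in `h`
and the current queue length is `q`. -/
structure Policy (M : Model) where
  rule : (n : ℕ) → M.History n → M.State → M.Action → ℝ
  nonneg : ∀ n h q s, 0 ≤ rule n h q s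
  sum_eq_one : ∀ n h q, ∑ s, rule n h q s = 1
  feasible : ∀ n h q s, ¬ M.Feasible q s → rule n h q s = 0

/-- A stationary randomized feasible policy: `f q s` is the probability of transmitting `s`
packets when the queue length is `q`. -/
structure StationaryPolicy (M : Model) where
  f : M.State → M.Action → ℝ
  nonneg : ∀ q s, 0 ≤ f q s
  sum_eq_one : ∀ q, ∑ s, f q s = 1
  feasible : ∀ q s, ¬ M.Feasible q s → f q s = 0

/-- A stationary policy, as a policy that ignores time and history. -/
def StationaryPolicy.toPolicy {M : Model} (F : M.StationaryPolicy) : M.Policy where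
  rule _ _ q s := F.f q s
  nonneg _ _ := F.nonneg
  sum_eq_one _ _ := F.sum_eq_one
  feasible _ _ := F.feasible

/-- The probability, under the policy `γ` and from the initial queue length `q₀`, that the first
`n` timeslots go as recorded in the history and that timeslot `n + 1` then starts with the given
queue length. -/
noncomputable def histProb {M : Model} (γ : M.Policy) (q₀ : M.State) :
    (n : ℕ) → M.History n → M.State → ℝ
  | 0, _, q => if q = q₀ then 1 else 0
  | n + 1, h, j =>
      histProb γ q₀ n (Fin.init h) (h (Fin.last n)).1
        * γ.rule n (Fin.init h) (h (Fin.last n)).1 (h (Fin.last n)).2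
        * M.transProb (h (Fin.last n)).1 (h (Fin.last n)).2 j

/-- The expected value of a cost `c q s` of the queue length and the action in timeslot
`n + 1`. -/
noncomputable def expCost {M : Model} (γ : M.Policy) (q₀ : M.State)
    (c : M.State → M.Action → ℝ) (n : ℕ) : ℝ :=
  ∑ h : M.History n, ∑ q : M.State, ∑ s : M.Action,
    histProb γ q₀ n h q * γ.rule n h q s * c q s

/-- The expected average power consumption over the first `N` timeslots. -/
noncomputable def meanPower {M : Model} (γ : M.Policy) (q₀ : M.State) (N : ℕ) : ℝ :=
  (1 / (N : ℝ)) * ∑ n ∈ Finset.range N, expCost γ q₀ (fun _ s => M.P s.val) n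

/-- The expected average queue length over the first `N` timeslots, divided by the mean number
`α A` of packets arriving per timeslot. -/
noncomputable def meanDelay {M : Model} (γ : M.Policy) (q₀ : M.State) (N : ℕ) : ℝ :=
  (1 / (M.α * (M.A : ℝ))) *
    ((1 / (N : ℝ)) * ∑ n ∈ Finset.range N, expCost γ q₀ (fun q _ => (q.val : ℝ)) n)

/-- The long-run average power of a policy. The averages are bounded, so the upper limit is a
genuine real number; it is the limit whenever the limit exists. -/
noncomputable def avgPower {M : Model} (γ : M.Policy) (q₀ : M.State) : ℝ :=
  limsup (meanPower γ q₀) atTop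

/-- The long-run average delay of a policy (upper limit, as for the power). -/
noncomputable def avgDelay {M : Model} (γ : M.Policy) (q₀ : M.State) : ℝ :=
  limsup (meanDelay γ q₀) atTop

/-- `γ` minimizes the average delay, among all policies that satisfy the average power
constraint, for the initial queue length `q₀`. -/
def IsDelayOptimal {M : Model} (Pth : ℝ) (q₀ : M.State) (γ : M.Policy) : Prop :=
  avgPower γ q₀ ≤ Pth ∧
    ∀ γ' : M.Policy, avgPower γ' q₀ ≤ Pth → avgDelay γ q₀ ≤ avgDelay γ' q₀

/-- The threshold preceding the one of `s`: `θ (s - 1)`, and `-1` for `s = 0`. -/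
def prevThreshold {M : Model} (θ : M.Action → M.State) (s : M.Action) : ℤ :=
  if s.val = 0 then -1
  else ((θ ⟨s.val - 1, lt_of_le_of_lt (Nat.sub_le _ _) s.isLt⟩).val : ℤ)

/-- The probability of transmitting `s + 1` packets in state `q`, which is `0` for `s = S`. -/
noncomputable def nextProb {M : Model} (f : M.State → M.Action → ℝ) (q : M.State)
    (s : M.Action) : ℝ :=
  if h : s.val + 1 < M.S + 1 then f q ⟨s.val + 1, h⟩ else 0

/-- The threshold form with thresholds `θ` that randomizes at most in the state `θ s'`, between
transmitting `s'` and `s' + 1` packets. -/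
structure HasThresholdForm {M : Model} (f : M.State → M.Action → ℝ) (θ : M.Action → M.State)
    (s' : M.Action) : Prop where
  monotone : Monotone θ
  eq_one : ∀ q s, s ≠ s' → prevThreshold θ s < (q.val : ℤ) → q ≤ θ s → f q s = 1
  eq_one_special : ∀ q, prevThreshold θ s' < (q.val : ℤ) → q < θ s' → f q s' = 1
  sum_special : f (θ s') s' + nextProb f (θ s') s' = 1
  eq_zero : ∀ q s,
    ¬ (s ≠ s' ∧ prevThreshold θ s < (q.val : ℤ) ∧ q ≤ θ s) →
    ¬ (s = s' ∧ prevThreshold θ s' < (q.val : ℤ) ∧ q < θ s') →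
    ¬ (q = θ s' ∧ (s = s' ∨ s.val = s'.val + 1)) → f q s = 0

end Model

end BufferedScheduling

/-! ### Expected costs along random histories -/

namespace BufferedScheduling
namespace Model

variable {M : Model}

/-! Price power at a multiplier `lam ≥ 0` and minimize queue length plus `lam` times power. In the
discounted problem, the Bellman update minus the queue length is an infimal convolution of the
convex power cost and the convex expected future value, so value iteration preserves convexity.
Exchange arguments then make the least minimizer regular: transmitted and remaining packets both
grow with the queue, which yields thresholds. The gain of a regular policy does not depend on the
initial state (`IsRegular.exists_poisson`).

Call a regular policy high if its average power exceeds `Pth`, and low otherwise. The multipliers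
with a high, respectively low, optimal policy form closed sets that cover `[0, Λ]`. By connectedness
some multiplier admits both kinds, unless a low policy is optimal at `0` or a high one at `Λ`
(`exists_crossing`). As deterministic policies are finite in number, this alternative survives the
limit of vanishing discount (`exists_average_crossing`).

A low policy optimal at `0` minimizes the delay outright; a high one at a large `Λ` contradicts the
existence of an admissible policy. Otherwise, since the minimizing actions in each state form an
interval, regular optimal policies can be joined by changes of one packet in one state, and two
neighbours lie on different sides of `Pth` (`exists_adjacent`). A mixture of them has power exactly
`Pth` (`exists_mixture_poisson`), still minimizes the Lagrangian, and is optimal by weak duality and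
complementary slackness (`optimal_of_lagrangian`). -/

lemma transProb_nonneg (q : M.State) (s : M.Action) (j : M.State) : 0 ≤ M.transProb q s j := by
  unfold transProb
  have h1 := M.α_pos
  have h2 := M.α_lt_one
  split_ifs <;> linarith

/-- Extension of a function on the states to all natural numbers, by zero. -/
noncomputable def extend (V : M.State → ℝ) (n : ℕ) : ℝ :=
  if h : n < M.Q + 1 then V ⟨n, h⟩ else 0

/-- Expected value of `V` at the next queue length when `y` packets are left after the
transmission. -/
noncomputable def nextMean (V : M.State → ℝ) (y : ℕ) : ℝ :=
  M.α * extend V (y + M.A) + (1 - M.α) * extend V y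

lemma sum_transProb_mul (V : M.State → ℝ) {q : M.State} {s : M.Action} (hf : M.Feasible q s) :
    ∑ j, M.transProb q s j * V j = nextMean V (q.val - s.val) := by
  obtain ⟨h1, h2⟩ := hf
  have hA := M.A_pos
  have hq := q.isLt
  have ha : q.val - s.val + M.A < M.Q + 1 := by omega
  have hb : q.val - s.val < M.Q + 1 := by omega
  -- The two successor states are distinct because `A ≥ 1`, so the nested conditional splits into a
  -- sum.
  have key : ∀ j : M.State, M.transProb q s j * V j =
      (if j = ⟨q.val - s.val + M.A, ha⟩ then M.α * V j else 0) +
      (if j = ⟨q.val - s.val, hb⟩ then (1 - M.α) * V j else 0) := by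
    intro j
    unfold transProb
    simp only [Fin.ext_iff]
    split_ifs <;> first | omega | ring
  rw [Finset.sum_congr rfl fun j _ => key j, Finset.sum_add_distrib]
  simp [nextMean, extend, ha, hb]

lemma histProb_nonneg (γ : M.Policy) (q₀ : M.State) :
    ∀ (n : ℕ) (h : M.History n) (q : M.State), 0 ≤ histProb γ q₀ n h q
  | 0, _, q => by
    unfold histProb
    split_ifs <;> norm_num
  | n + 1, h, j => by
    unfold histProb
    exact mul_nonneg (mul_nonneg (histProb_nonneg γ q₀ n _ _) (γ.nonneg _ _ _ _))
      (transProb_nonneg _ _ _)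

/-- The expected value of `w` at the queue length in timeslot `n + 1`. -/
noncomputable def stateMean (γ : M.Policy) (q₀ : M.State) (w : M.State → ℝ) (n : ℕ) : ℝ :=
  ∑ h : M.History n, ∑ q : M.State, histProb γ q₀ n h q * w q

lemma expCost_state (γ : M.Policy) (q₀ : M.State) (w : M.State → ℝ) (n : ℕ) :
    expCost γ q₀ (fun q _ => w q) n = stateMean γ q₀ w n := by
  unfold expCost stateMean
  refine Finset.sum_congr rfl fun h _ => Finset.sum_congr rfl fun q _ => ?_
  rw [← Finset.sum_mul, ← Finset.mul_sum, γ.sum_eq_one, mul_one]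

lemma stateMean_zero (γ : M.Policy) (q₀ : M.State) (w : M.State → ℝ) :
    stateMean γ q₀ w 0 = w q₀ := by
  simp [stateMean, histProb]

lemma stateMean_succ (γ : M.Policy) (q₀ : M.State) (w : M.State → ℝ) (n : ℕ) :
    stateMean γ q₀ w (n + 1) =
      expCost γ q₀ (fun q s => ∑ j, M.transProb q s j * w j) n := by
  unfold stateMean expCost
  -- A history of `n + 1` slots is a history of `n` slots followed by one pair.
  rw [← (Fin.snocEquiv (fun _ : Fin (n + 1) => M.State × M.Action)).sum_comp,
    Fintype.sum_prod_type_right]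
  refine Finset.sum_congr rfl fun h _ => ?_
  rw [Fintype.sum_prod_type]
  refine Finset.sum_congr rfl fun q _ => Finset.sum_congr rfl fun s _ => ?_
  rw [Finset.mul_sum]
  refine Finset.sum_congr rfl fun j _ => ?_
  simp [Fin.snocEquiv, histProb, mul_assoc]

lemma expCost_mono (γ : M.Policy) (q₀ : M.State) {c c' : M.State → M.Action → ℝ}
    (hc : ∀ q s, M.Feasible q s → c q s ≤ c' q s) (n : ℕ) :
    expCost γ q₀ c n ≤ expCost γ q₀ c' n := by
  unfold expCost
  refine Finset.sum_le_sum fun h _ => Finset.sum_le_sum fun q _ => Finset.sum_le_sum fun s _ => ?_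
  by_cases hf : M.Feasible q s
  · exact mul_le_mul_of_nonneg_left (hc q s hf)
      (mul_nonneg (histProb_nonneg _ _ _ _ _) (γ.nonneg _ _ _ _))
  · simp [γ.feasible n h q s hf]

lemma expCost_congr (γ : M.Policy) (q₀ : M.State) {c c' : M.State → M.Action → ℝ}
    (hc : ∀ q s, M.Feasible q s → c q s = c' q s) (n : ℕ) :
    expCost γ q₀ c n = expCost γ q₀ c' n :=
  le_antisymm (expCost_mono γ q₀ (fun q s h => (hc q s h).le) n)
    (expCost_mono γ q₀ (fun q s h => (hc q s h).ge) n)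

lemma expCost_add (γ : M.Policy) (q₀ : M.State) (c c' : M.State → M.Action → ℝ) (n : ℕ) :
    expCost γ q₀ (fun q s => c q s + c' q s) n = expCost γ q₀ c n + expCost γ q₀ c' n := by
  simp only [expCost, mul_add, Finset.sum_add_distrib]

lemma expCost_const_mul (γ : M.Policy) (q₀ : M.State) (a : ℝ) (c : M.State → M.Action → ℝ)
    (n : ℕ) : expCost γ q₀ (fun q s => a * c q s) n = a * expCost γ q₀ c n := by
  simp only [expCost, Finset.mul_sum]
  refine Finset.sum_congr rfl fun h _ => Finset.sum_congr rfl fun q _ =>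
    Finset.sum_congr rfl fun s _ => by ring

lemma stateMean_one (γ : M.Policy) (q₀ : M.State) (n : ℕ) :
    stateMean γ q₀ (fun _ => 1) n = 1 := by
  induction n with
  | zero => rw [stateMean_zero]
  | succ n ih =>
    rw [stateMean_succ]
    refine Eq.trans ?_ ((expCost_state γ q₀ (fun _ => 1) n).trans ih)
    refine expCost_congr γ q₀ (fun q s hf => ?_) n
    have h1 := hf.1
    have h2 := hf.2
    have hq := q.isLt
    have ha : q.val - s.val + M.A < M.Q + 1 := by omega
    have hb : q.val - s.val < M.Q + 1 := by omega
    rw [sum_transProb_mul _ hf]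
    simp [nextMean, extend, ha, hb]

lemma expCost_const (γ : M.Policy) (q₀ : M.State) (a : ℝ) (n : ℕ) :
    expCost γ q₀ (fun _ _ => a) n = a := by
  have h := expCost_const_mul γ q₀ a (fun _ _ => 1) n
  rw [expCost_state γ q₀ (fun _ => 1), stateMean_one, mul_one] at h
  simpa using h

lemma abs_expCost_le (γ : M.Policy) (q₀ : M.State) {c : M.State → M.Action → ℝ} {C : ℝ}
    (hc : ∀ q s, |c q s| ≤ C) (n : ℕ) : |expCost γ q₀ c n| ≤ C := by
  rw [abs_le]
  constructor
  · rw [← expCost_const γ q₀ (-C) n]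
    exact expCost_mono γ q₀ (fun q s _ => (abs_le.1 (hc q s)).1) n
  · rw [← expCost_const γ q₀ C n]
    exact expCost_mono γ q₀ (fun q s _ => (abs_le.1 (hc q s)).2) n

lemma abs_stateMean_le (γ : M.Policy) (q₀ : M.State) {w : M.State → ℝ} {C : ℝ}
    (hw : ∀ q, |w q| ≤ C) (n : ℕ) : |stateMean γ q₀ w n| ≤ C := by
  rw [← expCost_state]
  exact abs_expCost_le γ q₀ (fun q _ => hw q) n

lemma exists_abs_bound (w : M.State → ℝ) : ∃ C, 0 ≤ C ∧ ∀ q, |w q| ≤ C :=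
  ⟨‖w‖, norm_nonneg _, fun q => norm_le_pi_norm w q⟩

/-! ### Long-run averages by telescoping -/

/-- The expected average of a cost over the first `N` timeslots. -/
noncomputable def meanCost (γ : M.Policy) (q₀ : M.State) (c : M.State → M.Action → ℝ) (N : ℕ) :
    ℝ :=
  (1 / (N : ℝ)) * ∑ n ∈ Finset.range N, expCost γ q₀ c n

lemma sum_expCost_drift (γ : M.Policy) (q₀ : M.State) (w : M.State → ℝ) (N : ℕ) :
    ∑ n ∈ Finset.range N,
      (expCost γ q₀ (fun q s => ∑ j, M.transProb q s j * w j) n - stateMean γ q₀ w n) =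
      stateMean γ q₀ w N - w q₀ := by
  simp only [← stateMean_succ]
  rw [Finset.sum_range_sub, stateMean_zero]

lemma tendsto_const_div (C : ℝ) : Tendsto (fun N : ℕ => C / (N : ℝ)) atTop (𝓝 0) :=
  tendsto_const_nhds.div_atTop tendsto_natCast_atTop_atTop

/-- A lower solution of the average-cost optimality inequalities bounds the mean cost of every
policy from below, up to an error of order `1 / N`. -/
lemma meanCost_ge (γ : M.Policy) (q₀ : M.State) {c : M.State → M.Action → ℝ} {g : ℝ}
    {w : M.State → ℝ}
    (hw : ∀ q s, M.Feasible q s → g + w q ≤ c q s + nextMean w (q.val - s.val)) :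
    ∃ C : ℝ, ∀ N : ℕ, 1 ≤ N → g - C / N ≤ meanCost γ q₀ c N := by
  obtain ⟨C, hC0, hC⟩ := exists_abs_bound w
  refine ⟨2 * C, fun N hN => ?_⟩
  have hN' : (0 : ℝ) < N := by exact_mod_cast hN
  have hstep : ∀ n, g + stateMean γ q₀ w n ≤ expCost γ q₀ c n +
      expCost γ q₀ (fun q s => ∑ j, M.transProb q s j * w j) n := by
    intro n
    rw [← expCost_add, ← expCost_state, ← expCost_const γ q₀ g n, ← expCost_add]
    refine expCost_mono γ q₀ (fun q s hf => ?_) n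
    rw [sum_transProb_mul _ hf]
    exact hw q s hf
  have hsum : ∑ n ∈ Finset.range N, g ≤ ∑ n ∈ Finset.range N, (expCost γ q₀ c n +
      (expCost γ q₀ (fun q s => ∑ j, M.transProb q s j * w j) n - stateMean γ q₀ w n)) :=
    Finset.sum_le_sum fun n _ => by linarith [hstep n]
  rw [Finset.sum_add_distrib, sum_expCost_drift, Finset.sum_const, Finset.card_range,
    nsmul_eq_mul] at hsum
  have h1 := (abs_le.1 (abs_stateMean_le γ q₀ hC N)).2
  have h2 := (abs_le.1 (hC q₀)).1
  unfold meanCost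
  rw [one_div_mul_eq_div, le_div_iff₀ hN', sub_mul, div_mul_cancel₀ _ hN'.ne']
  linarith

lemma expCost_toPolicy (F : M.StationaryPolicy) (q₀ : M.State) (c : M.State → M.Action → ℝ)
    (n : ℕ) :
    expCost F.toPolicy q₀ c n = stateMean F.toPolicy q₀ (fun q => ∑ s, F.f q s * c q s) n := by
  unfold expCost stateMean
  refine Finset.sum_congr rfl fun h _ => Finset.sum_congr rfl fun q _ => ?_
  rw [Finset.mul_sum]
  refine Finset.sum_congr rfl fun s _ => ?_
  simp [StationaryPolicy.toPolicy, mul_assoc]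

/-- A solution of the Poisson equation of a stationary policy gives its average cost. -/
lemma tendsto_meanCost (F : M.StationaryPolicy) {c : M.State → M.Action → ℝ} {g : ℝ}
    {w : M.State → ℝ}
    (hw : ∀ q, g + w q = ∑ s, F.f q s * (c q s + nextMean w (q.val - s.val))) (q₀ : M.State) :
    Tendsto (meanCost F.toPolicy q₀ c) atTop (𝓝 g) := by
  obtain ⟨C, hC0, hC⟩ := exists_abs_bound w
  have hstep : ∀ n, g + stateMean F.toPolicy q₀ w n = expCost F.toPolicy q₀ c n +
      expCost F.toPolicy q₀ (fun q s => ∑ j, M.transProb q s j * w j) n := by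
    intro n
    rw [← expCost_add, ← expCost_state, ← expCost_const F.toPolicy q₀ g n, ← expCost_add,
      expCost_state F.toPolicy q₀ (fun q => g + w q), expCost_toPolicy]
    congr 1
    funext q
    rw [hw]
    refine Finset.sum_congr rfl fun s _ => ?_
    by_cases hf : M.Feasible q s
    · rw [sum_transProb_mul _ hf]
    · rw [F.feasible q s hf, zero_mul, zero_mul]
  have hmean : ∀ N : ℕ, 1 ≤ N → |meanCost F.toPolicy q₀ c N - g| ≤ 2 * C / N := by
    intro N hN
    have hN' : (0 : ℝ) < N := by exact_mod_cast hN
    have hsum : ∑ n ∈ Finset.range N, g = ∑ n ∈ Finset.range N, (expCost F.toPolicy q₀ c n +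
        (expCost F.toPolicy q₀ (fun q s => ∑ j, M.transProb q s j * w j) n
          - stateMean F.toPolicy q₀ w n)) :=
      Finset.sum_congr rfl fun n _ => by linarith [hstep n]
    rw [Finset.sum_add_distrib, sum_expCost_drift, Finset.sum_const, Finset.card_range,
      nsmul_eq_mul] at hsum
    have h1 := abs_le.1 (abs_stateMean_le F.toPolicy q₀ hC N)
    have h2 := abs_le.1 (hC q₀)
    have h3 : meanCost F.toPolicy q₀ c N - g =
        (w q₀ - stateMean F.toPolicy q₀ w N) / N := by
      unfold meanCost
      rw [one_div_mul_eq_div]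
      field_simp
      linarith
    rw [h3, abs_div, abs_of_pos hN']
    refine div_le_div_of_nonneg_right ?_ hN'.le
    rw [abs_le]
    constructor <;> linarith [h1.1, h1.2, h2.1, h2.2]
  rw [tendsto_iff_dist_tendsto_zero]
  refine squeeze_zero' (Eventually.of_forall fun _ => dist_nonneg) ?_ (tendsto_const_div (2 * C))
  filter_upwards [eventually_ge_atTop 1] with N hN
  rw [Real.dist_eq]
  exact hmean N hN

lemma abs_meanCost_le (γ : M.Policy) (q₀ : M.State) {c : M.State → M.Action → ℝ} {C : ℝ}
    (hc : ∀ q s, |c q s| ≤ C) (N : ℕ) : |meanCost γ q₀ c N| ≤ C := by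
  rcases Nat.eq_zero_or_pos N with rfl | hN
  · simpa [meanCost] using (abs_nonneg _).trans (hc q₀ 0)
  · have hN' : (0 : ℝ) < N := by exact_mod_cast hN
    unfold meanCost
    rw [one_div_mul_eq_div, abs_div, abs_of_pos hN', div_le_iff₀ hN']
    refine (Finset.abs_sum_le_sum_abs _ _).trans ?_
    refine (Finset.sum_le_sum fun n _ => abs_expCost_le γ q₀ hc n).trans ?_
    simp [mul_comm]

lemma meanCost_add (γ : M.Policy) (q₀ : M.State) (c c' : M.State → M.Action → ℝ) (N : ℕ) :
    meanCost γ q₀ (fun q s => c q s + c' q s) N = meanCost γ q₀ c N + meanCost γ q₀ c' N := by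
  simp only [meanCost, expCost_add, Finset.sum_add_distrib, mul_add]

lemma meanCost_const_mul (γ : M.Policy) (q₀ : M.State) (a : ℝ) (c : M.State → M.Action → ℝ)
    (N : ℕ) : meanCost γ q₀ (fun q s => a * c q s) N = a * meanCost γ q₀ c N := by
  simp only [meanCost, expCost_const_mul, ← Finset.mul_sum]
  ring

/-! ### The expected next value as an operator -/

lemma extend_of_lt (V : M.State → ℝ) {n : ℕ} (h : n < M.Q + 1) : extend V n = V ⟨n, h⟩ := by
  simp only [extend, h, dite_true]

lemma extend_add (V W : M.State → ℝ) (n : ℕ) :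
    extend (fun q => V q + W q) n = extend V n + extend W n := by
  unfold extend
  split_ifs <;> simp

lemma extend_mul (a : ℝ) (V : M.State → ℝ) (n : ℕ) :
    extend (fun q => a * V q) n = a * extend V n := by
  unfold extend
  split_ifs <;> simp

lemma nextMean_add (V W : M.State → ℝ) (y : ℕ) :
    nextMean (fun q => V q + W q) y = nextMean V y + nextMean W y := by
  simp only [nextMean, extend_add]
  ring

lemma nextMean_mul (a : ℝ) (V : M.State → ℝ) (y : ℕ) :
    nextMean (fun q => a * V q) y = a * nextMean V y := by
  simp only [nextMean, extend_mul]
  ring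

lemma nextMean_const (a : ℝ) {y : ℕ} (hy : y + M.A ≤ M.Q) :
    nextMean (fun _ : M.State => a) y = a := by
  rw [nextMean, extend_of_lt _ (by omega), extend_of_lt _ (by omega)]
  ring

lemma nextMean_mono {V W : M.State → ℝ} (h : ∀ q, V q ≤ W q) (y : ℕ) :
    nextMean V y ≤ nextMean W y := by
  have h1 := M.α_pos
  have h2 := M.α_lt_one
  have key : ∀ n, extend V n ≤ extend W n := by
    intro n
    unfold extend
    split_ifs
    · exact h _
    · exact le_rfl
  exact add_le_add (mul_le_mul_of_nonneg_left (key _) h1.le)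
    (mul_le_mul_of_nonneg_left (key _) (by linarith))

lemma Feasible.sub_add_le {q : M.State} {s : M.Action} (h : M.Feasible q s) :
    q.val - s.val + M.A ≤ M.Q := by
  have h1 := h.1
  have h2 := h.2
  omega

/-! ### Regular policies and their Poisson equation -/

/-- A deterministic stationary policy for which both the number of transmitted packets and the
number of remaining packets are nondecreasing in the queue length. -/
structure IsRegular (f : M.State → M.Action) : Prop where
  feasible : ∀ q, M.Feasible q (f q)
  mono : ∀ q q', q ≤ q' → f q ≤ f q'
  lipschitz : ∀ q q' : M.State, q ≤ q' → (f q').val + q.val ≤ (f q).val + q'.val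

lemma IsRegular.of_step {f : M.State → M.Action} (hf : ∀ q, M.Feasible q (f q))
    (hstep : ∀ q q' : M.State, q'.val = q.val + 1 →
      (f q).val ≤ (f q').val ∧ (f q').val ≤ (f q).val + 1) : IsRegular f := by
  have key : ∀ (n : ℕ) (q q' : M.State), q'.val = q.val + n →
      (f q).val ≤ (f q').val ∧ (f q').val ≤ (f q).val + n := by
    intro n
    induction n with
    | zero =>
      intro q q' h
      have : q' = q := Fin.ext (by omega)
      subst this
      simp
    | succ n ih =>
      intro q q' h
      have hq' := q'.isLt
      have h1 := ih q ⟨q.val + n, by omega⟩ rfl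
      have h2 := hstep ⟨q.val + n, by omega⟩ q' (by simp only; omega)
      omega
  refine ⟨hf, fun q q' h => ?_, fun q q' h => ?_⟩
  · exact (key (q'.val - q.val) q q' (by have : q.val ≤ q'.val := h; omega)).1
  · have : q.val ≤ q'.val := h
    have := (key (q'.val - q.val) q q' (by omega)).2
    omega

lemma IsRegular.exists_idle {f : M.State → M.Action} (hf : IsRegular f) :
    ∃ θ : M.State, (f θ).val = 0 ∧ ∀ q, θ < q → 1 ≤ (f q).val := by
  classical
  have hne : (Finset.univ.filter fun q : M.State => (f q).val = 0).Nonempty := by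
    refine ⟨0, ?_⟩
    have := (hf.feasible 0).1
    simp only [Finset.mem_filter, Finset.mem_univ, true_and]
    simpa using this
  refine ⟨_, (Finset.mem_filter.1 (Finset.max'_mem _ hne)).2, fun q hq => ?_⟩
  by_contra h
  have : q ∈ Finset.univ.filter fun q : M.State => (f q).val = 0 := by
    simp only [Finset.mem_filter, Finset.mem_univ, true_and]
    omega
  exact absurd (Finset.le_max' _ q this) (not_le.2 hq)

/-- Maximum principle: a subharmonic function attains its maximum in the largest idle state. -/
lemma IsRegular.le_idle {f : M.State → M.Action} (hf : IsRegular f) {θ : M.State}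
    (hθ : (f θ).val = 0) (hθ' : ∀ q, θ < q → 1 ≤ (f q).val) {w : M.State → ℝ}
    (hw : ∀ q, w q ≤ nextMean w (q.val - (f q).val)) (q : M.State) : w q ≤ w θ := by
  classical
  obtain ⟨m, hm⟩ := Finite.exists_max w
  have h0 := M.α_pos
  have h1 := M.α_lt_one
  have hA := M.A_pos
  -- Both successors have positive weight, so from a maximizer the chain moves only to maximizers.
  have closed : ∀ q, w q = w m →
      (∃ j : M.State, j.val = q.val - (f q).val + M.A ∧ w j = w m) ∧
      (∃ j : M.State, j.val = q.val - (f q).val ∧ w j = w m) := by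
    intro q hq
    have hfe := (hf.feasible q).sub_add_le
    have hq' := hw q
    rw [nextMean, extend_of_lt _ (by omega), extend_of_lt _ (by omega), hq] at hq'
    have ha := hm ⟨q.val - (f q).val + M.A, by omega⟩
    have hb := hm ⟨q.val - (f q).val, by omega⟩
    refine ⟨⟨_, rfl, le_antisymm ha ?_⟩, ⟨_, rfl, le_antisymm hb ?_⟩⟩ <;> nlinarith
  let K := Finset.univ.filter fun q : M.State => w q = w m
  have hK : K.Nonempty := ⟨m, by simp [K]⟩
  have hmax := Finset.max'_mem K hK
  -- A maximizer up to `θ` is idle, and an arrival leads from it to a larger maximizer.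
  have hlarge : θ < K.max' hK := by
    by_contra hle
    have hle : K.max' hK ≤ θ := not_lt.1 hle
    have hz := hf.mono _ _ hle
    have hz' : (f (K.max' hK)).val ≤ (f θ).val := hz
    obtain ⟨⟨j, hj, hj'⟩, -⟩ := closed _ (Finset.mem_filter.1 hmax).2
    have := Finset.le_max' K j (by simp [K, hj'])
    have : j.val ≤ (K.max' hK).val := this
    omega
  let K' := K.filter fun q => θ ≤ q
  have hK' : K'.Nonempty := ⟨_, Finset.mem_filter.2 ⟨hmax, hlarge.le⟩⟩
  have hmin := Finset.mem_filter.1 (Finset.min'_mem K' hK')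
  have hwm := (Finset.mem_filter.1 hmin.1).2
  rcases hmin.2.eq_or_lt with heq | hlt
  · rw [← heq] at hwm
    rw [hwm]
    exact hm q
  -- Above `θ` at least one packet leaves, but by `lipschitz` at least `θ` packets remain; without
  -- an arrival this gives a smaller maximizer that is still at least `θ`.
  · exfalso
    have h2 := hθ' _ hlt
    have h3 := hf.lipschitz _ _ hlt.le
    obtain ⟨-, j, hj, hj'⟩ := closed _ hwm
    have h4 : θ.val < (K'.min' hK').val := hlt
    have h5 := (hf.feasible (K'.min' hK')).1
    have := Finset.min'_le K' j (by
      simp only [K', K, Finset.mem_filter, Finset.mem_univ, true_and]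
      refine ⟨hj', ?_⟩
      change θ.val ≤ j.val
      omega)
    have : (K'.min' hK').val ≤ j.val := this
    omega

/-- The Poisson equation of a regular policy is solvable with a constant gain. -/
lemma IsRegular.exists_poisson {f : M.State → M.Action} (hf : IsRegular f) (c : M.State → ℝ) :
    ∃ (g : ℝ) (w : M.State → ℝ), ∀ q, g + w q = c q + nextMean w (q.val - (f q).val) := by
  obtain ⟨θ, hθ, hθ'⟩ := hf.exists_idle
  -- Adding `w θ` makes the system square: the value of the solution at `θ` serves as the gain.
  let L : (M.State → ℝ) →ₗ[ℝ] (M.State → ℝ) :=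
    { toFun := fun w q => w q - nextMean w (q.val - (f q).val) + w θ
      map_add' := by
        intro v w
        funext q
        have : nextMean (v + w) (q.val - (f q).val) = _ := nextMean_add v w _
        simp only [Pi.add_apply, this]
        ring
      map_smul' := by
        intro a w
        funext q
        have : nextMean (a • w) (q.val - (f q).val) = _ := nextMean_mul a w _
        simp only [Pi.smul_apply, smul_eq_mul, RingHom.id_apply, this]
        ring }
  have hinj : Function.Injective L := by
    rw [← LinearMap.ker_eq_bot, LinearMap.ker_eq_bot']
    intro w hw
    have hw' : ∀ q, w q - nextMean w (q.val - (f q).val) + w θ = 0 := fun q => congrFun hw q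
    -- The equation at a maximum of `w` gives `w θ ≤ 0`, and at a minimum `w θ ≥ 0`.
    have hθ0 : w θ = 0 := by
      obtain ⟨m, hm⟩ := Finite.exists_max w
      obtain ⟨m', hm'⟩ := Finite.exists_min w
      have h1 := nextMean_mono hm (m.val - (f m).val)
      have h2 := nextMean_mono hm' (m'.val - (f m').val)
      rw [nextMean_const _ (hf.feasible _).sub_add_le] at h1 h2
      have := hw' m
      have := hw' m'
      linarith
    funext q
    have h1 := hf.le_idle hθ hθ' (w := w) (fun q => by linarith [hw' q]) q
    have h2 := hf.le_idle hθ hθ' (w := fun q => -1 * w q)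
      (fun q => by rw [nextMean_mul]; linarith [hw' q]) q
    simp only [Pi.zero_apply]
    linarith
  obtain ⟨w, hw⟩ := LinearMap.injective_iff_surjective.1 hinj c
  refine ⟨w θ, w, fun q => ?_⟩
  have : w q - nextMean w (q.val - (f q).val) + w θ = c q := congrFun hw q
  linarith

end Model

/-! ### Convexity and exchange arguments -/

/-- Convexity of a sequence on `{0, …, N}`. -/
def ConvexUpTo (N : ℕ) (φ : ℕ → ℝ) : Prop :=
  ∀ a b, a ≤ b → b + 1 ≤ N → φ (a + 1) + φ b ≤ φ a + φ (b + 1)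

lemma ConvexUpTo.lt {N : ℕ} {φ : ℕ → ℝ} (h : ConvexUpTo N φ) {a b : ℕ} (hab : a < b)
    (hb : b ≤ N) : φ (a + 1) + φ (b - 1) ≤ φ a + φ b := by
  obtain ⟨c, rfl⟩ : ∃ c, b = c + 1 := ⟨b - 1, by omega⟩
  exact h a c (by omega) hb

/-- The infimal convolution of convex sequences is convex. -/
lemma convexUpTo_infConv {S N K : ℕ} {φ G F : ℕ → ℝ} (hφ : ConvexUpTo S φ) (hG : ConvexUpTo N G)
    (hle : ∀ s y, s ≤ S → y ≤ N → s + y ≤ K → F (s + y) ≤ φ s + G y)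
    (hatt : ∀ q ≤ K, ∃ s y, s ≤ S ∧ y ≤ N ∧ s + y = q ∧ F q = φ s + G y) :
    ConvexUpTo K F := by
  intro a b hab hb
  obtain ⟨s₁, y₁, hs₁, hy₁, h₁, e₁⟩ := hatt a (by omega)
  obtain ⟨s₂, y₂, hs₂, hy₂, h₂, e₂⟩ := hatt (b + 1) hb
  rw [e₁, e₂]
  -- The total `b + 1` exceeds `a`, so one of the two summands is larger in its decomposition; a
  -- unit of that summand is moved from the larger total to the smaller.
  by_cases h : s₁ < s₂
  · have i₁ := hle (s₁ + 1) y₁ (by omega) hy₁ (by omega)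
    have i₂ := hle (s₂ - 1) y₂ (by omega) hy₂ (by omega)
    have i₃ := hφ.lt h hs₂
    rw [show s₁ + 1 + y₁ = a + 1 by omega] at i₁
    rw [show s₂ - 1 + y₂ = b by omega] at i₂
    linarith
  · have i₁ := hle s₁ (y₁ + 1) hs₁ (by omega) (by omega)
    have i₂ := hle s₂ (y₂ - 1) hs₂ (by omega) (by omega)
    have i₃ := hG.lt (show y₁ < y₂ by omega) hy₂
    rw [show s₁ + (y₁ + 1) = a + 1 by omega] at i₁
    rw [show s₂ + (y₂ - 1) = b by omega] at i₂
    linarith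

namespace Model

variable {M : Model}

lemma convexUpTo_P : ConvexUpTo M.S M.P := by
  intro a b hab
  induction b, hab using Nat.le_induction with
  | base => intro _; linarith
  | succ b hab ih =>
    intro hb
    have h1 := ih (by omega)
    have h2 := M.P_convex b (by omega)
    rw [show b + 1 + 1 = b + 2 by omega]
    linarith

lemma convexUpTo_nextMean {V : M.State → ℝ} (hV : ConvexUpTo M.Q (extend V)) :
    ConvexUpTo (M.Q - M.A) (nextMean V) := by
  intro a b hab hb
  have hA := M.A_le_Q
  have h0 := M.α_pos
  have h1 := M.α_lt_one
  have i₁ := hV a b hab (by omega)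
  have i₂ := hV (a + M.A) (b + M.A) (by omega) (by omega)
  have i₃ := mul_le_mul_of_nonneg_left i₁ (sub_nonneg.2 h1.le)
  have i₄ := mul_le_mul_of_nonneg_left i₂ h0.le
  unfold nextMean
  rw [show a + 1 + M.A = a + M.A + 1 by omega, show b + 1 + M.A = b + M.A + 1 by omega]
  linarith

/-! ### Minimizing actions -/

/-- Cost of a timeslot with `s` transmitted packets plus the discounted value of the next
queue length. -/
noncomputable def actionValue (β lam : ℝ) (V : M.State → ℝ) (q : M.State) (s : M.Action) : ℝ :=
  (q.val : ℝ) + lam * M.P s.val + β * nextMean V (q.val - s.val)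

lemma exists_feasible (q : M.State) : ∃ s, M.Feasible q s := by
  have h1 := M.A_le_S
  have h2 := M.A_le_Q
  have h3 := q.isLt
  refine ⟨⟨min q.val M.A, by omega⟩, ?_, ?_⟩ <;> simp only <;> omega

/-- The set of minimizing actions is an interval. -/
lemma actionValue_succ_le {β lam : ℝ} (hβ : 0 ≤ β) (hlam : 0 ≤ lam) {V : M.State → ℝ}
    (hV : ConvexUpTo M.Q (extend V)) {q : M.State} {m : ℝ}
    (hm : ∀ s, M.Feasible q s → m ≤ actionValue β lam V q s) {a b c : M.Action}
    (ha : M.Feasible q a) (hb : M.Feasible q b) (ham : actionValue β lam V q a = m)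
    (hbm : actionValue β lam V q b = m) (hab : a.val < b.val) (hc : c.val = a.val + 1) :
    M.Feasible q c ∧ actionValue β lam V q c = m := by
  have h1 := ha.1
  have h2 := ha.2
  have h3 := hb.1
  have h4 := hb.2
  have hbS := b.isLt
  have hcf : M.Feasible q c := ⟨by omega, by omega⟩
  have hdf : M.Feasible q ⟨b.val - 1, by omega⟩ := ⟨by simp only; omega, by simp only; omega⟩
  refine ⟨hcf, le_antisymm ?_ (hm c hcf)⟩
  -- By convexity the values at `a + 1` and `b - 1` sum to at most `2 * m`, and the one at `b - 1`
  -- is at least `m`.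
  have i := hm _ hdf
  have j₁ := mul_le_mul_of_nonneg_left ((convexUpTo_P (M := M)).lt hab (by omega)) hlam
  have j₂ := mul_le_mul_of_nonneg_left ((convexUpTo_nextMean hV).lt
    (show q.val - b.val < q.val - a.val by omega) (by omega)) hβ
  rw [show q.val - b.val + 1 = q.val - (b.val - 1) by omega,
    show q.val - a.val - 1 = q.val - c.val by omega] at j₂
  unfold actionValue at *
  rw [hc] at j₂ ⊢
  simp only at i
  linarith

/-- The least minimizer of the action value of a convex function is a regular policy. -/
lemma exists_isRegular_min {β lam : ℝ} (hβ : 0 ≤ β) (hlam : 0 ≤ lam) {V : M.State → ℝ}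
    (hV : ConvexUpTo M.Q (extend V)) :
    ∃ f : M.State → M.Action, IsRegular f ∧
      ∀ q s, M.Feasible q s → actionValue β lam V q (f q) ≤ actionValue β lam V q s := by
  classical
  have hex : ∀ q : M.State, ∃ a, M.Feasible q a ∧
      (∀ s, M.Feasible q s → actionValue β lam V q a ≤ actionValue β lam V q s) ∧
      ∀ s, M.Feasible q s → s.val < a.val → actionValue β lam V q a < actionValue β lam V q s := by
    intro q
    let D := Finset.univ.filter fun s => M.Feasible q s
    have hD : D.Nonempty := by
      obtain ⟨s, hs⟩ := exists_feasible q
      exact ⟨s, by simp [D, hs]⟩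
    obtain ⟨b, hb, hbmin⟩ := Finset.exists_min_image D (actionValue β lam V q) hD
    let E := D.filter fun s => actionValue β lam V q s = actionValue β lam V q b
    have hE : E.Nonempty := ⟨b, Finset.mem_filter.2 ⟨hb, rfl⟩⟩
    have hmem := Finset.mem_filter.1 (Finset.min'_mem E hE)
    refine ⟨E.min' hE, (Finset.mem_filter.1 hmem.1).2, fun s hs => ?_, fun s hs hlt => ?_⟩
    · rw [hmem.2]
      exact hbmin s (by simp [D, hs])
    · rw [hmem.2]
      refine lt_of_le_of_ne (hbmin s (by simp [D, hs])) fun heq => ?_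
      have : s ∈ E := Finset.mem_filter.2 ⟨by simp [D, hs], heq.symm⟩
      exact absurd (Finset.min'_le E s this) (not_le.2 hlt)
  choose f hf hmin hleast using hex
  refine ⟨f, IsRegular.of_step hf fun q q' hq => ⟨?_, ?_⟩, hmin⟩
  -- If `f` drops from `q` to `q + 1`, interchange the two actions: the powers cancel, and convexity
  -- of the future value contradicts strict minimality at `q`.
  · by_contra hlt
    have hlt : (f q').val < (f q).val := not_le.1 hlt
    have h1 := (hf q).1
    have h2 := (hf q).2
    have h3 := (hf q').1
    have h4 := (hf q').2
    have e₁ : M.Feasible q (f q') := ⟨by omega, by omega⟩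
    have e₂ : M.Feasible q' (f q) := ⟨by omega, by omega⟩
    have i₁ := hleast q _ e₁ hlt
    have i₂ := hmin q' _ e₂
    have i₃ := mul_le_mul_of_nonneg_left ((convexUpTo_nextMean hV).lt
      (show q.val - (f q).val < q'.val - (f q').val by omega) (by omega)) hβ
    rw [show q.val - (f q).val + 1 = q'.val - (f q).val by omega,
      show q'.val - (f q').val - 1 = q.val - (f q').val by omega] at i₃
    unfold actionValue at i₁ i₂
    linarith
  -- If `f` rises by more than one, use `f q' - 1` at `q` and `f q + 1` at `q'`: the future values
  -- cancel, and convexity of `P` contradicts strict minimality at `q'`.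
  · by_contra hlt
    have hlt : (f q).val + 1 < (f q').val := not_le.1 hlt
    have h0 := (f q').isLt
    have h1 := (hf q).1
    have h2 := (hf q).2
    have h3 := (hf q').1
    have h4 := (hf q').2
    have e₁ : M.Feasible q ⟨(f q').val - 1, by omega⟩ := ⟨by simp only; omega, by simp only; omega⟩
    have e₂ : M.Feasible q' ⟨(f q).val + 1, by omega⟩ := ⟨by simp only; omega, by simp only; omega⟩
    have i₁ := hmin q _ e₁
    have i₂ := hleast q' _ e₂ hlt
    have i₃ := mul_le_mul_of_nonneg_left ((convexUpTo_P (M := M)).lt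
      (show (f q).val < (f q').val by omega) (by omega)) hlam
    unfold actionValue at i₁ i₂
    simp only at i₁ i₂
    rw [show q.val - ((f q').val - 1) = q'.val - (f q').val by omega] at i₁
    rw [show q'.val - ((f q).val + 1) = q.val - (f q).val by omega] at i₂
    linarith

/-! ### The discounted problem -/

section Discounted

open Classical in
/-- The Bellman operator of the discounted problem. -/
noncomputable def bellman (β lam : ℝ) (V : M.State → ℝ) (q : M.State) : ℝ :=
  (Finset.univ.filter fun s => M.Feasible q s).inf'
    ((exists_feasible q).imp fun _ h => Finset.mem_filter.2 ⟨Finset.mem_univ _, h⟩)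
    (actionValue β lam V q)

lemma bellman_le (β lam : ℝ) (V : M.State → ℝ) {q : M.State} {s : M.Action}
    (h : M.Feasible q s) : bellman β lam V q ≤ actionValue β lam V q s := by
  classical
  exact Finset.inf'_le _ (Finset.mem_filter.2 ⟨Finset.mem_univ _, h⟩)

lemma exists_bellman_eq (β lam : ℝ) (V : M.State → ℝ) (q : M.State) :
    ∃ s, M.Feasible q s ∧ bellman β lam V q = actionValue β lam V q s := by
  classical
  obtain ⟨s, hs, h⟩ := Finset.exists_mem_eq_inf' (s := Finset.univ.filter fun s => M.Feasible q s)
    ((exists_feasible q).imp fun _ h => Finset.mem_filter.2 ⟨Finset.mem_univ _, h⟩)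
    (actionValue β lam V q)
  exact ⟨s, (Finset.mem_filter.1 hs).2, by rw [← h]; unfold bellman; congr⟩

lemma bellman_convex {β lam : ℝ} (hβ : 0 ≤ β) (hlam : 0 ≤ lam) {V : M.State → ℝ}
    (hV : ConvexUpTo M.Q (extend V)) : ConvexUpTo M.Q (extend (bellman β lam V)) := by
  have hA := M.A_le_Q
  -- The holding cost is linear in `q`, so it can be removed. Feasibility says exactly that the
  -- remainder `y` satisfies `0 ≤ y ≤ Q - A`, hence the rest is an infimal convolution.
  have key : ConvexUpTo M.Q fun q => extend (bellman β lam V) q - q := by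
    refine convexUpTo_infConv (S := M.S) (N := M.Q - M.A) (φ := fun s => lam * M.P s)
      (G := fun y => β * nextMean V y) ?_ ?_ ?_ ?_
    · intro a b hab hb
      have := mul_le_mul_of_nonneg_left (convexUpTo_P a b hab hb) hlam
      linarith
    · intro a b hab hb
      have := mul_le_mul_of_nonneg_left (convexUpTo_nextMean hV a b hab hb) hβ
      linarith
    · intro s y hs hy hsy
      have hlt : s + y < M.Q + 1 := by omega
      have hfe : M.Feasible ⟨s + y, hlt⟩ ⟨s, by omega⟩ :=
        ⟨by simp only; omega, by simp only; omega⟩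
      have := bellman_le β lam V hfe
      rw [extend_of_lt _ hlt]
      unfold actionValue at this
      simp only [Nat.add_sub_cancel_left] at this
      linarith
    · intro q hq
      obtain ⟨s, hs, h⟩ := exists_bellman_eq β lam V ⟨q, by omega⟩
      have h1 := hs.1
      have h2 := hs.2
      have h3 := s.isLt
      simp only at h1 h2
      refine ⟨s.val, q - s.val, by omega, by omega, by omega, ?_⟩
      rw [extend_of_lt _ (by omega), h]
      unfold actionValue
      ring
  intro a b hab hb
  have := key a b hab hb
  push_cast at this
  linarith

lemma nextMean_le_add_dist (V W : M.State → ℝ) {y : ℕ} (hy : y + M.A ≤ M.Q) :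
    nextMean V y ≤ nextMean W y + dist V W := by
  rw [← nextMean_const (dist V W) hy, ← nextMean_add]
  refine nextMean_mono (fun q => ?_) y
  have h1 := dist_le_pi_dist V W q
  rw [Real.dist_eq] at h1
  linarith [le_abs_self (V q - W q)]

/-- Serves twice: equal multipliers give the contraction property, and two fixed points give
Lipschitz dependence on the multiplier. -/
lemma dist_bellman_le {β : ℝ} (hβ : 0 ≤ β) (lam lam' : ℝ) (V W : M.State → ℝ) :
    dist (bellman β lam V) (bellman β lam' W) ≤
      β * dist V W + |lam - lam'| * ∑ s : M.Action, |M.P s.val| := by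
  have key : ∀ (l l' : ℝ) (V W : M.State → ℝ) (q : M.State),
      bellman β l V q ≤ bellman β l' W q +
        (β * dist V W + |l - l'| * ∑ s : M.Action, |M.P s.val|) := by
    intro l l' V W q
    obtain ⟨s, hs, h⟩ := exists_bellman_eq β l' W q
    refine (bellman_le β l V hs).trans ?_
    rw [h]
    have h1 := mul_le_mul_of_nonneg_left (nextMean_le_add_dist V W hs.sub_add_le) hβ
    have h2 : |M.P s.val| ≤ ∑ s : M.Action, |M.P s.val| :=
      Finset.single_le_sum (f := fun s : M.Action => |M.P s.val|) (fun _ _ => abs_nonneg _)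
        (Finset.mem_univ s)
    have h3 := mul_le_mul_of_nonneg_left h2 (abs_nonneg (l - l'))
    have h4 := le_abs_self ((l - l') * M.P s.val)
    rw [abs_mul] at h4
    unfold actionValue
    linarith
  rw [dist_pi_le_iff (by positivity)]
  intro q
  rw [Real.dist_eq, abs_le]
  have h1 := key lam lam' V W q
  have h2 := key lam' lam W V q
  rw [dist_comm W V, abs_sub_comm lam' lam] at h2
  constructor <;> linarith

lemma isClosed_convexUpTo : IsClosed {V : M.State → ℝ | ConvexUpTo M.Q (extend V)} := by
  have hc : ∀ n, Continuous fun V : M.State → ℝ => extend V n := by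
    intro n
    unfold extend
    split_ifs <;> fun_prop
  simp only [ConvexUpTo, Set.ofPred_forall]
  refine isClosed_iInter fun a => isClosed_iInter fun b => isClosed_iInter fun _ =>
    isClosed_iInter fun _ => isClosed_le ?_ ?_
  · exact (hc _).add (hc _)
  · exact (hc _).add (hc _)

/-- The value function of the discounted problem: it exists, depends continuously on the
multiplier, and is convex. -/
lemma exists_discounted_value {β : ℝ} (hβ : 0 ≤ β) (hβ' : β < 1) :
    ∃ V : ℝ → M.State → ℝ, Continuous V ∧ (∀ lam, bellman β lam (V lam) = V lam) ∧
      ∀ lam, 0 ≤ lam → ConvexUpTo M.Q (extend (V lam)) := by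
  have hK : ∀ lam, ContractingWith ⟨β, hβ⟩ (bellman (M := M) β lam) := by
    refine fun lam => ⟨by exact_mod_cast hβ', LipschitzWith.of_dist_le_mul fun V W => ?_⟩
    have := dist_bellman_le hβ lam lam V W
    rw [sub_self, abs_zero, zero_mul, add_zero] at this
    exact this
  have hfix : ∀ lam, bellman β lam ((hK lam).fixedPoint) = (hK lam).fixedPoint :=
    fun lam => (hK lam).fixedPoint_isFixedPt
  refine ⟨fun lam => (hK lam).fixedPoint, ?_, hfix, fun lam hlam => ?_⟩
  · set C := ∑ s : M.Action, |M.P s.val| with hC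
    have hC0 : 0 ≤ C := Finset.sum_nonneg fun _ _ => abs_nonneg _
    have h1 : 0 < 1 - β := by linarith
    -- The constant solves `d ≤ β * d + |l - l'| * C` for the distance `d` of the fixed points.
    refine LipschitzWith.continuous (K := ⟨C / (1 - β), by positivity⟩)
      (LipschitzWith.of_dist_le_mul fun l l' => ?_)
    have h2 := dist_bellman_le hβ l l' ((hK l).fixedPoint) ((hK l').fixedPoint)
    rw [hfix, hfix] at h2
    change _ ≤ C / (1 - β) * _
    rw [div_mul_eq_mul_div, le_div_iff₀ h1, Real.dist_eq l l']
    linarith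
  -- Value iteration starts at zero and stays in the closed set of convex functions.
  · refine isClosed_convexUpTo.mem_of_tendsto ((hK lam).tendsto_iterate_fixedPoint fun _ => 0)
      (Eventually.of_forall fun n => ?_)
    induction n with
    | zero =>
      intro a b hab hb
      simp [extend]
    | succ n ih =>
      rw [Set.mem_ofPred_eq, Function.iterate_succ_apply']
      exact bellman_convex hβ hlam ih

end Discounted

/-! ### Paths of one-packet changes -/

/-- Two regular policies need not be comparable; their maximum is a regular policy to which both can
be raised. -/
lemma IsRegular.sup {f f' : M.State → M.Action} (hf : IsRegular f) (hf' : IsRegular f') :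
    IsRegular fun q => max (f q) (f' q) := by
  refine ⟨fun q => ?_, fun q q' h => max_le_max (hf.mono q q' h) (hf'.mono q q' h),
    fun q q' h => ?_⟩
  · rcases max_choice (f q) (f' q) with e | e <;> rw [e]
    · exact hf.feasible q
    · exact hf'.feasible q
  · have h1 := hf.lipschitz q q' h
    have h2 := hf'.lipschitz q q' h
    have h3 : (f q).val ≤ (max (f q) (f' q)).val := le_max_left (f q) (f' q)
    have h4 : (f' q).val ≤ (max (f q) (f' q)).val := le_max_right (f q) (f' q)
    rcases max_choice (f q') (f' q') with e | e <;> simp only [e] <;> omega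

/-- Between two comparable regular policies one can raise the lower one by one packet in a single
state, keeping it regular and below the upper one. -/
lemma IsRegular.exists_raise {f f' : M.State → M.Action} (hf : IsRegular f) (hf' : IsRegular f')
    (hle : ∀ q, f q ≤ f' q) (hne : f ≠ f') :
    ∃ (q : M.State) (c : M.Action), c.val = (f q).val + 1 ∧ c ≤ f' q ∧
      (M.Feasible q c → IsRegular (Function.update f q c)) := by
  classical
  let D := Finset.univ.filter fun q => f q < f' q
  have hD : D.Nonempty := by
    by_contra h
    refine hne (funext fun q => le_antisymm (hle q) (not_lt.1 fun hlt => h ⟨q, ?_⟩))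
    simp [D, hlt]
  -- The weight encodes a lexicographic choice: least `f q` first, then largest `q`. Then `f`
  -- already jumps to the right of `q` and is flat to its left, as otherwise a neighbour would be a
  -- better choice.
  obtain ⟨q, hq, hmin⟩ := Finset.exists_min_image D
    (fun q => (f q).val * (M.Q + 1) + (M.Q - q.val)) hD
  have hlt : (f q).val < (f' q).val := (Finset.mem_filter.1 hq).2
  have hmin' : ∀ j : M.State, (f j).val < (f' j).val →
      (f q).val * (M.Q + 1) + (M.Q - q.val) ≤ (f j).val * (M.Q + 1) + (M.Q - j.val) :=
    fun j hj => hmin j (Finset.mem_filter.2 ⟨Finset.mem_univ _, hj⟩)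
  have hS := (f' q).isLt
  refine ⟨q, ⟨(f q).val + 1, by omega⟩, rfl, hlt, fun hc => IsRegular.of_step (fun j => ?_) ?_⟩
  · by_cases h : j = q
    · subst h
      rwa [Function.update_self]
    · rw [Function.update_of_ne h]
      exact hf.feasible j
  · intro j j' hj
    have hjj : j ≤ j' := by
      change j.val ≤ j'.val
      omega
    have h1 : (f j).val ≤ (f j').val := hf.mono j j' hjj
    have h2 := hf.lipschitz j j' hjj
    have h3 : (f' j).val ≤ (f' j').val := hf'.mono j j' hjj
    have h4 := hf'.lipschitz j j' hjj
    have h5 : (f j).val ≤ (f' j).val := hle j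
    by_cases hjq : j = q
    · subst hjq
      have hne' : j' ≠ j := fun h => by rw [h] at hj; omega
      rw [Function.update_self, Function.update_of_ne hne']
      simp only
      have : (f j').val ≠ (f j).val := by
        intro he
        have := hmin' j' (by omega)
        have := j'.isLt
        rw [he] at *
        omega
      omega
    · by_cases hjq' : j' = q
      · subst hjq'
        rw [Function.update_self, Function.update_of_ne hjq]
        simp only
        have : (f j).val = (f j').val := by
          by_contra he
          have hlt' : (f j).val + 1 ≤ (f j').val := by omega
          have := hmin' j (by omega)
          have h6 := Nat.mul_le_mul_right (M.Q + 1) hlt'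
          rw [add_mul] at h6
          omega
        omega
      · rw [Function.update_of_ne hjq, Function.update_of_ne hjq']
        omega

/-- If regular policies that choose from intervals `C q` of feasible actions are split into two
classes, and both classes occur, then they occur for two policies that differ by one packet in a
single state. -/
lemma exists_adjacent {C : M.State → M.Action → Prop} (hC : ∀ q s, C q s → M.Feasible q s)
    (hint : ∀ q (a b c : M.Action), C q a → C q b → a.val < b.val → c.val = a.val + 1 → C q c)
    (H : (M.State → M.Action) → Prop) {f f' : M.State → M.Action}
    (hf : IsRegular f) (hf' : IsRegular f') (hfC : ∀ q, C q (f q)) (hfC' : ∀ q, C q (f' q))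
    (hH : H f) (hH' : ¬ H f') :
    ∃ (f₀ : M.State → M.Action) (q : M.State) (c : M.Action), c.val = (f₀ q).val + 1 ∧
      IsRegular f₀ ∧ IsRegular (Function.update f₀ q c) ∧ (∀ j, C j (f₀ j)) ∧
      (∀ j, C j (Function.update f₀ q c j)) ∧ ¬ (H f₀ ↔ H (Function.update f₀ q c)) := by
  -- For comparable policies, induct on the total gap. The class condition is symmetric, so either
  -- class may be the lower end.
  have key : ∀ (n : ℕ) (f f' : M.State → M.Action), ∑ q, ((f' q).val - (f q).val) = n →
      IsRegular f → IsRegular f' → (∀ q, C q (f q)) → (∀ q, C q (f' q)) → (∀ q, f q ≤ f' q) →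
      ¬ (H f ↔ H f') →
      ∃ (f₀ : M.State → M.Action) (q : M.State) (c : M.Action), c.val = (f₀ q).val + 1 ∧
      IsRegular f₀ ∧ IsRegular (Function.update f₀ q c) ∧ (∀ j, C j (f₀ j)) ∧
      (∀ j, C j (Function.update f₀ q c j)) ∧ ¬ (H f₀ ↔ H (Function.update f₀ q c)) := by
    intro n
    induction n using Nat.strong_induction_on with
    | _ n ih =>
      intro f f' hn hf hf' hfC hfC' hle hH
      have hne : f ≠ f' := fun h => hH (by rw [h])
      obtain ⟨q, c, hc, hcle, hreg⟩ := hf.exists_raise hf' hle hne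
      have hcle' : c.val ≤ (f' q).val := hcle
      have hCc := hint q _ _ c (hfC q) (hfC' q) (by omega) hc
      have hreg := hreg (hC _ _ hCc)
      have hCup : ∀ j, C j (Function.update f q c j) := by
        intro j
        by_cases h : j = q
        · subst h
          rwa [Function.update_self]
        · rw [Function.update_of_ne h]
          exact hfC j
      by_cases hHu : H f ↔ H (Function.update f q c)
      · refine ih _ ?_ (Function.update f q c) f' rfl hreg hf' hCup hfC' ?_
          (fun h => hH (hHu.trans h))
        · rw [← hn]
          refine Finset.sum_lt_sum (fun j _ => ?_) ⟨q, Finset.mem_univ _, ?_⟩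
          · by_cases h : j = q
            · subst h
              rw [Function.update_self]
              omega
            · rw [Function.update_of_ne h]
          · rw [Function.update_self]
            omega
        · intro j
          by_cases h : j = q
          · subst h
            rwa [Function.update_self]
          · rw [Function.update_of_ne h]
            exact hle j
      · exact ⟨f, q, c, hc, hf, hreg, hfC, hCup, hHu⟩
  have hsC : ∀ q, C q (max (f q) (f' q)) := by
    intro q
    rcases max_choice (f q) (f' q) with e | e <;> rw [e]
    · exact hfC q
    · exact hfC' q
  -- The maximum differs in class from one of the two policies; the path starts there.
  by_cases hs : H fun q => max (f q) (f' q)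
  · exact key _ f' _ rfl hf' (hf.sup hf') hfC' hsC (fun q => le_max_right _ _)
      (fun h => hH' (h.2 hs))
  · exact key _ f _ rfl hf (hf.sup hf') hfC hsC (fun q => le_max_left _ _) (fun h => hs (h.1 hH))

/-! ### Mixing two policies that differ in one state -/

/-- At a maximum of `w` the expected next value cannot exceed `w`. Applied to differences of
relative values, this compares gains. -/
lemma gain_nonpos {f : M.State → M.Action} (hf : ∀ q, M.Feasible q (f q)) {δ : ℝ}
    {w : M.State → ℝ} (h : ∀ q, δ + w q ≤ nextMean w (q.val - (f q).val)) : δ ≤ 0 := by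
  obtain ⟨m, hm⟩ := Finite.exists_max w
  have h1 := nextMean_mono hm (m.val - (f m).val)
  rw [nextMean_const _ (hf m).sub_add_le] at h1
  linarith [h m]

lemma nextMean_sub (V W : M.State → ℝ) (y : ℕ) :
    nextMean (fun q => V q - W q) y = nextMean V y - nextMean W y := by
  have h1 := nextMean_add V (fun q => -1 * W q) y
  rw [nextMean_mul] at h1
  rw [sub_eq_add_neg, ← neg_one_mul, ← h1]
  congr 1
  funext q
  ring

/-- If two deterministic policies differ in a single state, every gain between theirs is the gain
of a mixture of the two. -/
lemma exists_mixture_poisson {f₀ f₁ : M.State → M.Action} {q' : M.State}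
    (hf₀ : ∀ q, M.Feasible q (f₀ q)) (hf₁ : ∀ q, M.Feasible q (f₁ q))
    (heq : ∀ q, q ≠ q' → f₀ q = f₁ q) {c : M.State → M.Action → ℝ} {g₀ g₁ g : ℝ}
    {w₀ w₁ : M.State → ℝ}
    (h₀ : ∀ q, g₀ + w₀ q = c q (f₀ q) + nextMean w₀ (q.val - (f₀ q).val))
    (h₁ : ∀ q, g₁ + w₁ q = c q (f₁ q) + nextMean w₁ (q.val - (f₁ q).val))
    (hlt : g₀ < g₁) (hg₀ : g₀ ≤ g) (hg₁ : g ≤ g₁) :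
    ∃ (p : ℝ) (w : M.State → ℝ), 0 ≤ p ∧ p ≤ 1 ∧ ∀ q,
      g + w q = (1 - p) * (c q (f₀ q) + nextMean w (q.val - (f₀ q).val)) +
        p * (c q (f₁ q) + nextMean w (q.val - (f₁ q).val)) := by
  -- Residual in `q'` of the Poisson equation of one policy under the action of the other. Elsewhere
  -- the actions agree, so `g₀ < g₁` forces `v > 0` and `u < 0`.
  set v := c q' (f₁ q') + nextMean w₀ (q'.val - (f₁ q').val) - w₀ q' - g₀ with hv
  set u := c q' (f₀ q') + nextMean w₁ (q'.val - (f₀ q').val) - w₁ q' - g₁ with hu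
  have hvpos : 0 < v := by
    by_contra hneg
    have := gain_nonpos hf₁ (δ := g₁ - g₀) (w := fun q => w₁ q - w₀ q) fun q => by
      rw [nextMean_sub]
      have a₁ := h₁ q
      by_cases h : q = q'
      · subst h
        linarith
      · have a₀ := h₀ q
        rw [heq q h] at a₀
        linarith
    linarith
  have huneg : u < 0 := by
    by_contra hneg
    have := gain_nonpos hf₀ (δ := g₁ - g₀) (w := fun q => w₁ q - w₀ q) fun q => by
      rw [nextMean_sub]
      have a₀ := h₀ q
      by_cases h : q = q'
      · subst h
        linarith
      · have a₁ := h₁ q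
        rw [← heq q h] at a₁
        linarith
    linarith
  have hd : 0 < g₁ - g₀ := sub_pos.2 hlt
  set t := (g - g₀) / (g₁ - g₀) with ht
  have ht0 : 0 ≤ t := div_nonneg (sub_nonneg.2 hg₀) hd.le
  have ht1 : t ≤ 1 := (div_le_one hd).2 (by linarith)
  have hg : g = (1 - t) * g₀ + t * g₁ := by
    have : t * (g₁ - g₀) = g - g₀ := div_mul_cancel₀ _ hd.ne'
    linarith
  have n₁ : 0 ≤ t * -u := mul_nonneg ht0 (by linarith)
  have n₂ : 0 ≤ (1 - t) * v := mul_nonneg (by linarith) hvpos.le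
  have hden : 0 < t * -u + (1 - t) * v := by
    rcases ht0.eq_or_lt with h | h
    · rw [← h]
      linarith
    · have := mul_pos h (neg_pos.2 huneg)
      linarith
  -- The interpolated relative value leaves the residual `t * u` for the action of `f₀` and `(1 - t)
  -- * v` for that of `f₁`; this `p` makes their mean vanish.
  set p := t * -u / (t * -u + (1 - t) * v) with hp
  have hpeq : (1 - p) * (t * u) + p * ((1 - t) * v) = 0 := by
    have : p * (t * -u + (1 - t) * v) = t * -u := div_mul_cancel₀ _ hden.ne'
    linarith
  refine ⟨p, fun q => (1 - t) * w₀ q + t * w₁ q, div_nonneg n₁ hden.le,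
    (div_le_one hden).2 (by linarith), fun q => ?_⟩
  simp only [nextMean_add, nextMean_mul]
  have a₀ := h₀ q
  have a₁ := h₁ q
  by_cases h : q = q'
  · subst h
    have b₀ : c q (f₀ q) = g₀ + w₀ q - nextMean w₀ (q.val - (f₀ q).val) := by linarith
    have b₁ : c q (f₁ q) = g₁ + w₁ q - nextMean w₁ (q.val - (f₁ q).val) := by linarith
    rw [hg]
    have c₀ : c q (f₀ q) + ((1 - t) * nextMean w₀ (q.val - (f₀ q).val) +
        t * nextMean w₁ (q.val - (f₀ q).val)) =
        (1 - t) * (g₀ + w₀ q) + t * (g₁ + w₁ q) + t * u := by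
      rw [hu, a₀]
      ring
    have c₁ : c q (f₁ q) + ((1 - t) * nextMean w₀ (q.val - (f₁ q).val) +
        t * nextMean w₁ (q.val - (f₁ q).val)) =
        (1 - t) * (g₀ + w₀ q) + t * (g₁ + w₁ q) + (1 - t) * v := by
      rw [hv, a₁]
      ring
    rw [c₀, c₁]
    linarith
  · rw [heq q h] at a₀ ⊢
    rw [hg]
    linear_combination (1 - t) * a₀ + t * a₁

open Classical in
/-- The stationary policy that follows `f₁` with probability `p` and `f₀` with probability
`1 - p`. -/
noncomputable def mixture (f₀ f₁ : M.State → M.Action) (hf₀ : ∀ q, M.Feasible q (f₀ q))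
    (hf₁ : ∀ q, M.Feasible q (f₁ q)) (p : ℝ) (hp₀ : 0 ≤ p) (hp₁ : p ≤ 1) :
    M.StationaryPolicy where
  f q s := (1 - p) * (if s = f₀ q then 1 else 0) + p * (if s = f₁ q then 1 else 0)
  nonneg q s := by
    have : 0 ≤ 1 - p := by linarith
    split_ifs <;> linarith
  sum_eq_one q := by
    rw [Finset.sum_add_distrib, ← Finset.mul_sum, ← Finset.mul_sum]
    simp
  feasible q s h := by
    have h₀ : s ≠ f₀ q := fun e => h (e ▸ hf₀ q)
    have h₁ : s ≠ f₁ q := fun e => h (e ▸ hf₁ q)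
    simp [h₀, h₁]

lemma sum_mixture_mul {f₀ f₁ : M.State → M.Action} (hf₀ : ∀ q, M.Feasible q (f₀ q))
    (hf₁ : ∀ q, M.Feasible q (f₁ q)) {p : ℝ} (hp₀ : 0 ≤ p) (hp₁ : p ≤ 1) (q : M.State)
    (X : M.Action → ℝ) :
    ∑ s, (mixture f₀ f₁ hf₀ hf₁ p hp₀ hp₁).f q s * X s = (1 - p) * X (f₀ q) + p * X (f₁ q) := by
  simp only [mixture, add_mul, Finset.sum_add_distrib, mul_assoc, ← Finset.mul_sum, ite_mul,
    one_mul, zero_mul, Finset.sum_ite_eq', Finset.mem_univ, if_true]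

/-! ### Threshold form -/

/-- Let `θ s` be the largest state in which `f` transmits at most `s` packets. By monotonicity, `f q
= s` exactly between consecutive thresholds. The jump after `q'` makes `q'` the threshold of its own
action, so randomization in `q'` is allowed. -/
lemma exists_hasThresholdForm {F : M.State → M.Action → ℝ} {f : M.State → M.Action}
    {q' : M.State} (hf : IsRegular f)
    (hdet : ∀ q, q ≠ q' → ∀ s, F q s = if s.val = (f q).val then 1 else 0)
    (hjump : ∀ q, q' < q → f q' < f q)
    (hzero : ∀ s : M.Action, s ≠ f q' → s.val ≠ (f q').val + 1 → F q' s = 0)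
    (hsum : F q' (f q') + nextProb F q' (f q') = 1) :
    ∃ (θ : M.Action → M.State) (s' : M.Action), HasThresholdForm F θ s' := by
  classical
  have hne : ∀ s : M.Action, (Finset.univ.filter fun q => f q ≤ s).Nonempty := by
    intro s
    refine ⟨0, Finset.mem_filter.2 ⟨Finset.mem_univ _, ?_⟩⟩
    have h := (hf.feasible 0).1
    have h0 : (0 : M.State).val = 0 := rfl
    change (f 0).val ≤ s.val
    omega
  let θ : M.Action → M.State := fun s => (Finset.univ.filter fun q => f q ≤ s).max' (hne s)
  have hθ : ∀ q s, q ≤ θ s ↔ f q ≤ s := by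
    refine fun q s => ⟨fun h => ?_, fun h => ?_⟩
    · exact (hf.mono q (θ s) h).trans (Finset.mem_filter.1 (Finset.max'_mem _ (hne s))).2
    · exact Finset.le_max' _ q (Finset.mem_filter.2 ⟨Finset.mem_univ _, h⟩)
  have hprev : ∀ (q : M.State) (s : M.Action),
      prevThreshold θ s < (q.val : ℤ) ↔ s.val ≤ (f q).val := by
    intro q s
    unfold prevThreshold
    split_ifs with h
    · omega
    · have h1 := hθ q ⟨s.val - 1, lt_of_le_of_lt (Nat.sub_le _ _) s.isLt⟩
      have h2 : q.val ≤ (θ ⟨s.val - 1, lt_of_le_of_lt (Nat.sub_le _ _) s.isLt⟩).val ↔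
        (f q).val ≤ s.val - 1 := h1
      omega
  have hθ' : θ (f q') = q' := by
    refine le_antisymm (not_lt.1 fun h => ?_) ((hθ _ _).2 le_rfl)
    exact absurd ((hθ _ _).1 (le_refl (θ (f q')))) (not_le.2 (hjump _ h))
  refine ⟨θ, f q', ⟨fun s t hst => ?_, fun q s hs h1 h2 => ?_, fun q h1 h2 => ?_, ?_,
    fun q s h1 h2 h3 => ?_⟩⟩
  · rw [hθ]
    exact ((hθ _ _).1 le_rfl).trans hst
  · rw [hprev] at h1
    rw [hθ] at h2
    have h3 : s = f q := le_antisymm h1 h2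
    rw [hdet q (fun h => hs (by rw [h3, h]))]
    simp [h3]
  · rw [hprev] at h1
    have h3 : f q' = f q := le_antisymm h1 ((hθ _ _).1 h2.le)
    rw [hθ'] at h2
    rw [hdet q h2.ne]
    simp [h3]
  · rw [hθ']
    exact hsum
  · rw [hprev, hθ] at h1
    rw [hprev, hθ'] at h2
    rw [hθ'] at h3
    by_cases hq : q = q'
    · subst hq
      exact hzero s (fun h => h3 ⟨rfl, Or.inl h⟩) fun h => h3 ⟨rfl, Or.inr h⟩
    · rw [hdet q hq, if_neg]
      intro hs
      have hs : s = f q := Fin.ext hs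
      by_cases hs' : s = f q'
      · refine h2 ⟨hs', by rw [← hs', hs], lt_of_le_of_ne ?_ hq⟩
        rw [← hθ', hθ, ← hs, hs']
      · exact h1 ⟨hs', by rw [hs], by rw [hs]⟩

/-- A mixture of two regular policies that differ by one packet in a single state is of threshold
form. -/
lemma mixture_hasThresholdForm {f₀ : M.State → M.Action} {q' : M.State} {c : M.Action}
    (hc : c.val = (f₀ q').val + 1) (hf₀ : IsRegular f₀) (hf₁ : IsRegular (Function.update f₀ q' c))
    {F : M.State → M.Action → ℝ} {p : ℝ}
    (hF : ∀ q s, F q s = (1 - p) * (if s = f₀ q then 1 else 0) +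
      p * (if s = Function.update f₀ q' c q then 1 else 0)) :
    ∃ (θ : M.Action → M.State) (s' : M.Action), HasThresholdForm F θ s' := by
  have hc' : c ≠ f₀ q' := fun h => by rw [h] at hc; omega
  refine exists_hasThresholdForm hf₀ (q' := q') (fun q hq s => ?_) (fun q hq => ?_)
    (fun s h1 h2 => ?_) ?_
  · rw [hF, Function.update_of_ne hq]
    simp only [Fin.ext_iff]
    split_ifs <;> ring
  -- Monotonicity of the raised policy forces the lower one to jump right after `q'`.
  · have h1 := hf₁.mono q' q hq.le
    rw [Function.update_self, Function.update_of_ne hq.ne'] at h1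
    have h2 : c.val ≤ (f₀ q).val := h1
    change (f₀ q').val < (f₀ q).val
    omega
  · have h3 : s ≠ c := fun h => h2 (by rw [h, hc])
    rw [hF, Function.update_self, if_neg h1, if_neg h3]
    ring
  · have h3 : (f₀ q').val + 1 < M.S + 1 := by
      have := c.isLt
      omega
    have h4 : (⟨(f₀ q').val + 1, h3⟩ : M.Action) = c := Fin.ext hc.symm
    rw [nextProb, dif_pos h3, h4, hF, hF, Function.update_self, if_pos rfl, if_neg hc'.symm,
      if_neg hc', if_pos rfl]
    ring

/-- A regular deterministic policy is of threshold form. -/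
lemma deterministic_hasThresholdForm {f : M.State → M.Action} (hf : IsRegular f)
    {F : M.State → M.Action → ℝ} (hF : ∀ q s, F q s = if s = f q then 1 else 0) :
    ∃ (θ : M.Action → M.State) (s' : M.Action), HasThresholdForm F θ s' := by
  -- In the last state the jump condition is void, and the randomization there is trivial.
  refine exists_hasThresholdForm hf (q' := Fin.last M.Q) (fun q _ s => ?_) (fun q hq => ?_)
    (fun s h1 _ => ?_) ?_
  · rw [hF]
    simp only [Fin.ext_iff]
  · exact absurd hq (not_lt.2 (Fin.le_last q))
  · rw [hF, if_neg h1]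
  · rw [hF, if_pos rfl, nextProb]
    split_ifs with h
    · rw [hF, if_neg, add_zero]
      intro e
      have := congrArg Fin.val e
      simp only at this
      omega
    · rw [add_zero]

/-! ### Vanishing discount -/

lemma continuous_actionValue (q : M.State) (s : M.Action) :
    Continuous fun x : ℝ × ℝ × (M.State → ℝ) => actionValue x.1 x.2.1 x.2.2 q s := by
  have hc : ∀ n, Continuous fun V : M.State → ℝ => extend V n := by
    intro n
    unfold extend
    split_ifs <;> fun_prop
  have h1 := (hc (q.val - s.val)).comp (continuous_snd.comp
    (continuous_snd (X := ℝ) (Y := ℝ × (M.State → ℝ))))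
  have h2 := (hc (q.val - s.val + M.A)).comp (continuous_snd.comp
    (continuous_snd (X := ℝ) (Y := ℝ × (M.State → ℝ))))
  simp only [Function.comp_def] at h1 h2
  unfold actionValue nextMean
  fun_prop

/-- The discounted value of a policy differs from its normalized gain by a bounded amount. -/
lemma abs_discounted_sub_gain_le {f : M.State → M.Action} (hf : ∀ q, M.Feasible q (f q))
    {β lam g C : ℝ} (hβ : 0 ≤ β) (hβ' : β < 1) {V w : M.State → ℝ} (hC : ∀ q, |w q| ≤ C)
    (hV : ∀ q, V q = actionValue β lam V q (f q))
    (hw : ∀ q, g + w q = actionValue 1 lam w q (f q)) (q : M.State) :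
    |V q - g / (1 - β)| ≤ 2 * C := by
  have hd : 0 < 1 - β := by linarith
  set G := g / (1 - β) with hG
  have hg : g = (1 - β) * G := by
    rw [hG, mul_div_cancel₀ _ hd.ne']
  -- At the extrema of `W = V - w` the factor `1 - β` cancels, leaving a bound that does not depend
  -- on `β`.
  set W : M.State → ℝ := fun q => V q - w q with hW
  have hstep : ∀ q, W q = g + β * nextMean W (q.val - (f q).val) -
      (1 - β) * nextMean w (q.val - (f q).val) := by
    intro q
    have h1 := hV q
    have h2 := hw q
    unfold actionValue at h1 h2
    simp only [hW, nextMean_sub]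
    linarith
  have hlow : ∀ q, -C ≤ nextMean w (q.val - (f q).val) := fun q => by
    have := nextMean_mono (V := fun _ => -C) (fun q => (abs_le.1 (hC q)).1) (q.val - (f q).val)
    rwa [nextMean_const _ (hf q).sub_add_le] at this
  have hup : ∀ q, nextMean w (q.val - (f q).val) ≤ C := fun q => by
    have := nextMean_mono (W := fun _ => C) (fun q => (abs_le.1 (hC q)).2) (q.val - (f q).val)
    rwa [nextMean_const _ (hf q).sub_add_le] at this
  obtain ⟨m, hm⟩ := Finite.exists_max W
  obtain ⟨m', hm'⟩ := Finite.exists_min W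
  have b₁ : W m ≤ G + C := by
    have h1 := nextMean_mono hm (m.val - (f m).val)
    rw [nextMean_const _ (hf m).sub_add_le] at h1
    have h2 := mul_le_mul_of_nonneg_left h1 hβ
    have h3 := mul_le_mul_of_nonneg_left (hlow m) hd.le
    have h4 := hstep m
    refine le_of_mul_le_mul_left ?_ hd
    linarith
  have b₂ : G - C ≤ W m' := by
    have h1 := nextMean_mono hm' (m'.val - (f m').val)
    rw [nextMean_const _ (hf m').sub_add_le] at h1
    have h2 := mul_le_mul_of_nonneg_left h1 hβ
    have h3 := mul_le_mul_of_nonneg_left (hup m') hd.le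
    have h4 := hstep m'
    refine le_of_mul_le_mul_left ?_ hd
    linarith
  have h1 := hm q
  have h2 := hm' q
  have h3 := abs_le.1 (hC q)
  simp only [hW] at h1 h2 b₁ b₂
  rw [abs_le]
  constructor <;> linarith [h3.1, h3.2]

/-- The Poisson equation is linear in the cost. Separate solutions for queue and power bound the
relative values uniformly over a compact range of multipliers. -/
lemma IsRegular.exists_lagrangian_poisson {f : M.State → M.Action} (hf : IsRegular f) :
    ∃ (g₁ g₂ : ℝ) (w₁ w₂ : M.State → ℝ), ∀ lam q, g₁ + lam * g₂ + (w₁ q + lam * w₂ q) =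
      actionValue 1 lam (fun q => w₁ q + lam * w₂ q) q (f q) := by
  obtain ⟨g₁, w₁, h₁⟩ := hf.exists_poisson fun q => (q.val : ℝ)
  obtain ⟨g₂, w₂, h₂⟩ := hf.exists_poisson fun q => M.P (f q).val
  refine ⟨g₁, g₂, w₁, w₂, fun lam q => ?_⟩
  simp only [actionValue, nextMean_add, nextMean_mul]
  linear_combination h₁ q + lam * h₂ q

/-- Vanishing discount: if two regular policies attain the discounted value for multipliers in a
compact interval and discount factors that tend to one, then both attain the minimum in one and the
same average-cost optimality equation. -/
lemma exists_average_solution {β : ℕ → ℝ} (hβ : ∀ k, 0 ≤ β k) (hβ' : ∀ k, β k < 1)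
    {l : Filter ℕ} (U : Ultrafilter ℕ) (hUl : (U : Filter ℕ) ≤ l) (hlim : Tendsto β l (𝓝 1))
    {V : ℕ → ℝ → M.State → ℝ} (hV : ∀ k lam, bellman (β k) lam (V k lam) = V k lam)
    (hVc : ∀ k lam, 0 ≤ lam → ConvexUpTo M.Q (extend (V k lam)))
    {f f' : M.State → M.Action} (hf : IsRegular f) (hf' : IsRegular f') {a b : ℝ} (ha : 0 ≤ a)
    (h : ∀ᶠ k in (U : Filter ℕ), ∃ lam, lam ∈ Set.Icc a b ∧
      (∀ q, V k lam q = actionValue (β k) lam (V k lam) q (f q)) ∧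
      (∀ q, V k lam q = actionValue (β k) lam (V k lam) q (f' q))) :
    ∃ (lam g : ℝ) (w : M.State → ℝ), lam ∈ Set.Icc a b ∧ ConvexUpTo M.Q (extend w) ∧
      (∀ q s, M.Feasible q s → g + w q ≤ actionValue 1 lam w q s) ∧
      (∀ q, g + w q = actionValue 1 lam w q (f q)) ∧
      (∀ q, g + w q = actionValue 1 lam w q (f' q)) := by
  obtain ⟨lam, hlam⟩ : ∃ lam : ℕ → ℝ, ∀ᶠ k in (U : Filter ℕ), lam k ∈ Set.Icc a b ∧
      (∀ q, V k (lam k) q = actionValue (β k) (lam k) (V k (lam k)) q (f q)) ∧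
      (∀ q, V k (lam k) q = actionValue (β k) (lam k) (V k (lam k)) q (f' q)) := by
    classical
    refine ⟨fun k => if hk : _ then Classical.choose (p := fun lam => lam ∈ Set.Icc a b ∧
      (∀ q, V k lam q = actionValue (β k) lam (V k lam) q (f q)) ∧
      (∀ q, V k lam q = actionValue (β k) lam (V k lam) q (f' q))) hk else 0, ?_⟩
    filter_upwards [h] with k hk
    rw [dif_pos hk]
    exact Classical.choose_spec hk
  obtain ⟨g₁, g₂, w₁, w₂, hp⟩ := hf.exists_lagrangian_poisson
  obtain ⟨C₁, hC₁, hw₁⟩ := exists_abs_bound w₁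
  obtain ⟨C₂, hC₂, hw₂⟩ := exists_abs_bound w₂
  -- Normalizing at state `0` keeps the relative values bounded as the discount factor tends to one,
  -- and `hshift` shows that optimality is unaffected.
  let g : ℕ → ℝ := fun k => (1 - β k) * V k (lam k) 0
  let w : ℕ → M.State → ℝ := fun k q => V k (lam k) q - V k (lam k) 0
  set C := C₁ + b * C₂ with hC
  set K := |g₁| + b * |g₂| + 2 * C with hK
  have hshift : ∀ k q s, M.Feasible q s → actionValue (β k) (lam k) (w k) q s - w k q - g k =
      actionValue (β k) (lam k) (V k (lam k)) q s - V k (lam k) q := by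
    intro k q s hs
    simp only [actionValue, w, g]
    rw [nextMean_sub, nextMean_const _ hs.sub_add_le]
    ring
  have hbound : ∀ᶠ k in (U : Filter ℕ), (lam k, g k, w k) ∈
      Set.Icc a b ×ˢ (Metric.closedBall (0 : ℝ) K ×ˢ
        Metric.closedBall (0 : M.State → ℝ) (4 * C)) := by
    filter_upwards [hlam] with k hk
    obtain ⟨hmem, hkf, -⟩ := hk
    have hl0 : 0 ≤ lam k := ha.trans hmem.1
    have hCw : ∀ q, |w₁ q + lam k * w₂ q| ≤ C := fun q => by
      refine (abs_add_le _ _).trans (add_le_add (hw₁ q) ?_)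
      rw [abs_mul, abs_of_nonneg hl0]
      exact mul_le_mul hmem.2 (hw₂ q) (abs_nonneg _) (hl0.trans hmem.2)
    have hVb := abs_discounted_sub_gain_le hf.feasible (hβ k) (hβ' k) hCw hkf (hp (lam k))
    have hd : 0 < 1 - β k := sub_pos.2 (hβ' k)
    refine ⟨hmem, ?_, ?_⟩
    · rw [mem_closedBall_zero_iff, Real.norm_eq_abs]
      have e : g k = (g₁ + lam k * g₂) +
          (1 - β k) * (V k (lam k) 0 - (g₁ + lam k * g₂) / (1 - β k)) := by
        simp only [g]
        rw [mul_sub, mul_div_cancel₀ _ hd.ne']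
        ring
      rw [e]
      refine (abs_add_le _ _).trans (add_le_add ((abs_add_le _ _).trans (add_le_add le_rfl ?_)) ?_)
      · rw [abs_mul, abs_of_nonneg hl0]
        exact mul_le_mul_of_nonneg_right hmem.2 (abs_nonneg _)
      · rw [abs_mul, abs_of_pos hd]
        have h1 : 1 - β k ≤ 1 := by linarith [hβ k]
        exact (mul_le_of_le_one_left (abs_nonneg _) h1).trans (hVb 0)
    · rw [mem_closedBall_zero_iff]
      have hC0 : 0 ≤ C := (abs_nonneg _).trans (hCw 0)
      refine (pi_norm_le_iff_of_nonneg (by positivity)).2 fun q => ?_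
      rw [Real.norm_eq_abs, abs_le]
      have i₁ := abs_le.1 (hVb q)
      have i₂ := abs_le.1 (hVb 0)
      simp only [w]
      constructor <;> linarith [i₁.1, i₁.2, i₂.1, i₂.2]
  have hcomp : IsCompact (Set.Icc a b ×ˢ (Metric.closedBall (0 : ℝ) K ×ˢ
      Metric.closedBall (0 : M.State → ℝ) (4 * C))) :=
    isCompact_Icc.prod ((isCompact_closedBall _ _).prod (isCompact_closedBall _ _))
  -- Compactness makes the ultrafilter converge, without passing to subsequences.
  obtain ⟨⟨lam', g', w'⟩, hx, hle⟩ := hcomp.ultrafilter_le_nhds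
    (U.map fun k => (lam k, g k, w k)) (le_principal_iff.2 hbound)
  have ht : Tendsto (fun k => (lam k, g k, w k)) U (𝓝 (lam', g', w')) := hle
  have ht_lam : Tendsto lam U (𝓝 lam') := (continuous_fst.tendsto _).comp ht
  have ht_g : Tendsto g U (𝓝 g') :=
    ((continuous_fst.comp continuous_snd).tendsto _).comp ht
  have ht_w : Tendsto w U (𝓝 w') :=
    ((continuous_snd.comp continuous_snd).tendsto _).comp ht
  have ht_left : ∀ q, Tendsto (fun k => g k + w k q) U (𝓝 (g' + w' q)) := fun q =>
    ht_g.add ((tendsto_pi_nhds.1 ht_w) q)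
  have ht_right : ∀ q s, Tendsto (fun k => actionValue (β k) (lam k) (w k) q s) U
      (𝓝 (actionValue 1 lam' w' q s)) := fun q s =>
    ((continuous_actionValue q s).tendsto (1, lam', w')).comp
      ((hlim.mono_left hUl).prodMk_nhds (ht_lam.prodMk_nhds ht_w))
  refine ⟨lam', g', w', hx.1, ?_, fun q s hs => ?_, fun q => ?_, fun q => ?_⟩
  · refine isClosed_convexUpTo.mem_of_tendsto ht_w ?_
    filter_upwards [hlam] with k hk
    intro i j hij hj
    have hc := hVc k (lam k) (ha.trans hk.1.1) i j hij hj
    simp only [w]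
    rw [extend_of_lt _ (by omega), extend_of_lt _ (by omega), extend_of_lt _ (by omega),
      extend_of_lt _ (by omega)] at hc ⊢
    linarith
  · refine le_of_tendsto_of_tendsto (ht_left q) (ht_right q s) (Eventually.of_forall fun k => ?_)
    have h1 := bellman_le (β k) (lam k) (V k (lam k)) hs
    rw [hV] at h1
    have h2 := hshift k q s hs
    change g k + w k q ≤ _
    linarith
  · refine tendsto_nhds_unique_of_eventuallyEq (ht_left q) (ht_right q _) ?_
    filter_upwards [hlam] with k hk
    have h1 := hk.2.1 q
    have h2 := hshift k q _ (hf.feasible q)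
    linarith
  · refine tendsto_nhds_unique_of_eventuallyEq (ht_left q) (ht_right q _) ?_
    filter_upwards [hlam] with k hk
    have h1 := hk.2.2 q
    have h2 := hshift k q _ (hf'.feasible q)
    linarith

/-! ### Crossing from high to low power -/

lemma exists_tight {β lam : ℝ} (hβ : 0 ≤ β) (hlam : 0 ≤ lam) {V : M.State → ℝ}
    (hV : bellman β lam V = V) (hVc : ConvexUpTo M.Q (extend V)) :
    ∃ f, IsRegular f ∧ ∀ q, V q = actionValue β lam V q (f q) := by
  obtain ⟨f, hf, hmin⟩ := exists_isRegular_min hβ hlam hVc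
  refine ⟨f, hf, fun q => ?_⟩
  obtain ⟨s, hs, h⟩ := exists_bellman_eq β lam V q
  have h1 := bellman_le β lam V (hf.feasible q)
  rw [hV] at h h1
  exact le_antisymm h1 ((hmin q s hs).trans h.ge)

/-- If the regular policies are split into two classes, then one of the classes contains an optimal
policy of the discounted problem at an end of the range of multipliers, or there is a multiplier
for which both do. -/
lemma exists_crossing {β : ℝ} (hβ : 0 ≤ β) {V : ℝ → M.State → ℝ} (hc : Continuous V)
    (hV : ∀ lam, bellman β lam (V lam) = V lam)
    (hVc : ∀ lam, 0 ≤ lam → ConvexUpTo M.Q (extend (V lam)))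
    (H : (M.State → M.Action) → Prop) {Λ : ℝ} (hΛ : 0 ≤ Λ) :
    ∃ f f' : M.State → M.Action, IsRegular f ∧ IsRegular f' ∧
      ((¬ H f' ∧ ∀ q, V 0 q = actionValue β 0 (V 0) q (f' q)) ∨
      (H f ∧ ∀ q, V Λ q = actionValue β Λ (V Λ) q (f q)) ∨
      (H f ∧ ¬ H f' ∧ ∃ lam, lam ∈ Set.Icc 0 Λ ∧
        (∀ q, V lam q = actionValue β lam (V lam) q (f q)) ∧
        (∀ q, V lam q = actionValue β lam (V lam) q (f' q)))) := by
  classical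
  -- `K f` collects the multipliers at which `f` attains the value; it is closed because `V` is
  -- continuous. The finite unions `T` and `T'` cover the interval, so they intersect in it if both
  -- meet it.
  let K : (M.State → M.Action) → Set ℝ :=
    fun f => {lam | ∀ q, V lam q = actionValue β lam (V lam) q (f q)}
  have hK : ∀ f, IsClosed (K f) := by
    intro f
    simp only [K, Set.ofPred_forall]
    refine isClosed_iInter fun q => isClosed_eq ((continuous_apply q).comp hc) ?_
    exact (continuous_actionValue q (f q)).comp
      (continuous_const.prodMk (continuous_id.prodMk hc))
  let T : Set ℝ := ⋃ f ∈ {f | IsRegular f ∧ H f}, K f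
  let T' : Set ℝ := ⋃ f ∈ {f | IsRegular f ∧ ¬ H f}, K f
  have hT : IsClosed T := (Set.toFinite _).isClosed_biUnion fun f _ => hK f
  have hT' : IsClosed T' := (Set.toFinite _).isClosed_biUnion fun f _ => hK f
  have hcover : Set.Icc 0 Λ ⊆ T ∪ T' := by
    intro lam hlam
    obtain ⟨f, hf, ht⟩ := exists_tight hβ hlam.1 (hV lam) (hVc lam hlam.1)
    by_cases h : H f
    · exact Or.inl (Set.mem_biUnion (show f ∈ {f | IsRegular f ∧ H f} from ⟨hf, h⟩) ht)
    · exact Or.inr (Set.mem_biUnion (show f ∈ {f | IsRegular f ∧ ¬ H f} from ⟨hf, h⟩) ht)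
  obtain ⟨f₀, hf₀, ht₀⟩ := exists_tight hβ le_rfl (hV 0) (hVc 0 le_rfl)
  obtain ⟨f₁, hf₁, ht₁⟩ := exists_tight hβ hΛ (hV Λ) (hVc Λ hΛ)
  by_cases h₀ : H f₀
  · by_cases h₁ : H f₁
    · exact ⟨f₁, f₁, hf₁, hf₁, Or.inr (Or.inl ⟨h₁, ht₁⟩)⟩
    · obtain ⟨lam, hlam, hm, hm'⟩ := isPreconnected_closed_iff.1 isPreconnected_Icc T T' hT hT'
        hcover ⟨0, ⟨le_rfl, hΛ⟩, Set.mem_biUnion (show f₀ ∈ {f | IsRegular f ∧ H f} from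
          ⟨hf₀, h₀⟩) ht₀⟩ ⟨Λ, ⟨hΛ, le_rfl⟩, Set.mem_biUnion
          (show f₁ ∈ {f | IsRegular f ∧ ¬ H f} from ⟨hf₁, h₁⟩) ht₁⟩
      obtain ⟨f, hf, hfl⟩ := Set.mem_iUnion₂.1 hm
      obtain ⟨f', hf', hfl'⟩ := Set.mem_iUnion₂.1 hm'
      exact ⟨f, f', hf.1, hf'.1, Or.inr (Or.inr ⟨hf.2, hf'.2, lam, hlam, hfl, hfl'⟩)⟩
  · exact ⟨f₀, f₀, hf₀, hf₀, Or.inl ⟨h₀, ht₀⟩⟩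

/-- Pigeonhole principle: otherwise, on a common member of the ultrafilter, all of the finitely many
candidates would fail. -/
lemma _root_.Ultrafilter.exists_eventually_of_finite {ι X : Type*} [Finite X] (U : Ultrafilter ι)
    {R : ι → X → Prop} (h : ∀ i, ∃ x, R i x) : ∃ x, ∀ᶠ i in (U : Filter ι), R i x := by
  by_contra hne
  have h1 : ∀ x, ∀ᶠ i in (U : Filter ι), ¬ R i x := fun x =>
    Ultrafilter.eventually_not.2 fun hx => hne ⟨x, hx⟩
  obtain ⟨i, hi⟩ := (eventually_all.2 h1).exists
  obtain ⟨x, hx⟩ := h i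
  exact hi x hx

/-- The same alternative for the average-cost problem. -/
lemma exists_average_crossing (H : (M.State → M.Action) → Prop) {Λ : ℝ} (hΛ : 0 ≤ Λ) :
    ∃ (f f' : M.State → M.Action) (lam g : ℝ) (w : M.State → ℝ), IsRegular f ∧ IsRegular f' ∧
      0 ≤ lam ∧ ConvexUpTo M.Q (extend w) ∧
      (∀ q s, M.Feasible q s → g + w q ≤ actionValue 1 lam w q s) ∧
      ((¬ H f' ∧ lam = 0 ∧ ∀ q, g + w q = actionValue 1 lam w q (f' q)) ∨
      (H f ∧ lam = Λ ∧ ∀ q, g + w q = actionValue 1 lam w q (f q)) ∨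
      (H f ∧ ¬ H f' ∧ (∀ q, g + w q = actionValue 1 lam w q (f q)) ∧
        ∀ q, g + w q = actionValue 1 lam w q (f' q))) := by
  let β : ℕ → ℝ := fun k => 1 - 1 / ((k : ℝ) + 1)
  have hβ : ∀ k, 0 ≤ β k := fun k => by
    have : 1 / ((k : ℝ) + 1) ≤ 1 := by
      rw [div_le_one (by positivity)]
      linarith [k.cast_nonneg (α := ℝ)]
    simp only [β]
    linarith
  have hβ' : ∀ k, β k < 1 := fun k => by
    have : 0 < 1 / ((k : ℝ) + 1) := by positivity
    simp only [β]
    linarith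
  have hlim : Tendsto β atTop (𝓝 1) := by
    have := (tendsto_one_div_add_atTop_nhds_zero_nat (𝕜 := ℝ)).const_sub 1
    rwa [sub_zero] at this
  choose V hc hV hVc using fun k => exists_discounted_value (M := M) (hβ k) (hβ' k)
  let U := hyperfilter ℕ
  have hU : (U : Filter ℕ) ≤ atTop := by
    rw [← Nat.cofinite_eq_atTop]
    exact hyperfilter_le_cofinite
  obtain ⟨⟨f, f'⟩, h⟩ := U.exists_eventually_of_finite
    (X := (M.State → M.Action) × (M.State → M.Action))
    (R := fun k x => IsRegular x.1 ∧ IsRegular x.2 ∧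
      ((¬ H x.2 ∧ ∀ q, V k 0 q = actionValue (β k) 0 (V k 0) q (x.2 q)) ∨
      (H x.1 ∧ ∀ q, V k Λ q = actionValue (β k) Λ (V k Λ) q (x.1 q)) ∨
      (H x.1 ∧ ¬ H x.2 ∧ ∃ lam, lam ∈ Set.Icc 0 Λ ∧
        (∀ q, V k lam q = actionValue (β k) lam (V k lam) q (x.1 q)) ∧
        (∀ q, V k lam q = actionValue (β k) lam (V k lam) q (x.2 q)))))
    fun k => by
      obtain ⟨f, f', h⟩ := exists_crossing (hβ k) (hc k) (hV k) (hVc k) H hΛ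
      exact ⟨(f, f'), h⟩
  simp only at h
  have hf : IsRegular f := h.exists.choose_spec.1
  have hf' : IsRegular f' := h.exists.choose_spec.2.1
  have h := h.mono fun _ hk => hk.2.2
  rw [Ultrafilter.eventually_or, Ultrafilter.eventually_or] at h
  rcases h with h | h | h
  -- A degenerate interval of multipliers holds the limit at the endpoint.
  · obtain ⟨lam, g, w, hlam, hw, hle, heq, -⟩ := exists_average_solution hβ hβ' U hU hlim hV hVc
      hf' hf' (a := 0) (b := 0) le_rfl (h.mono fun k hk => ⟨0, ⟨le_rfl, le_rfl⟩, hk.2, hk.2⟩)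
    exact ⟨f, f', lam, g, w, hf, hf', hlam.1, hw, hle,
      Or.inl ⟨h.exists.choose_spec.1, le_antisymm hlam.2 hlam.1, heq⟩⟩
  · obtain ⟨lam, g, w, hlam, hw, hle, heq, -⟩ := exists_average_solution hβ hβ' U hU hlim hV hVc
      hf hf (a := Λ) (b := Λ) hΛ (h.mono fun k hk => ⟨Λ, ⟨le_rfl, le_rfl⟩, hk.2, hk.2⟩)
    exact ⟨f, f', lam, g, w, hf, hf', hΛ.trans hlam.1, hw, hle,
      Or.inr (Or.inl ⟨h.exists.choose_spec.1, le_antisymm hlam.2 hlam.1, heq⟩)⟩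
  · obtain ⟨lam, g, w, hlam, hw, hle, heq, heq'⟩ := exists_average_solution hβ hβ' U hU hlim hV hVc
      hf hf' (a := 0) (b := Λ) le_rfl (h.mono fun k hk => hk.2.2)
    exact ⟨f, f', lam, g, w, hf, hf', hlam.1, hw, hle,
      Or.inr (Or.inr ⟨h.exists.choose_spec.1, h.exists.choose_spec.2.1, heq, heq'⟩)⟩

/-! ### Duality and complementary slackness -/

/-- Weak duality. -/
lemma gain_le_of_avgPower_le {lam g : ℝ} {w : M.State → ℝ} (hlam : 0 ≤ lam)
    (hw : ∀ q s, M.Feasible q s → g + w q ≤ actionValue 1 lam w q s) {γ : M.Policy}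
    {q₀ : M.State} {Pth b : ℝ} (hP : avgPower γ q₀ ≤ Pth)
    (hb : ∀ᶠ N in atTop, meanCost γ q₀ (fun q _ => (q.val : ℝ)) N ≤ b) :
    g ≤ b + lam * Pth := by
  obtain ⟨C, hC⟩ := meanCost_ge γ q₀ (c := fun q s => (q.val : ℝ) + lam * M.P s.val) (g := g)
    (w := w) fun q s hs => by
      have := hw q s hs
      unfold actionValue at this
      linarith
  have hbdd : IsBoundedUnder (· ≤ ·) atTop (meanPower γ q₀) :=
    isBoundedUnder_of ⟨∑ s : M.Action, |M.P s.val|, fun N => (le_abs_self _).trans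
      (abs_meanCost_le γ q₀ (c := fun _ s => M.P s.val) (fun _ s => Finset.single_le_sum
        (f := fun s : M.Action => |M.P s.val|) (fun _ _ => abs_nonneg _) (Finset.mem_univ s)) N)⟩
  have key : ∀ ε : ℝ, 0 < ε → g ≤ b + lam * (Pth + ε) := by
    intro ε hε
    have h1 : ∀ᶠ N in atTop, meanPower γ q₀ N < Pth + ε :=
      eventually_lt_of_limsup_lt (hP.trans_lt (by linarith)) hbdd
    have h2 : Tendsto (fun N : ℕ => g - C / N) atTop (𝓝 (g - 0)) :=
      (tendsto_const_div C).const_sub g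
    rw [sub_zero] at h2
    refine le_of_tendsto h2 ?_
    filter_upwards [h1, hb, eventually_ge_atTop 1] with N hN1 hN2 hN3
    have h3 := hC N hN3
    rw [meanCost_add, meanCost_const_mul γ q₀ lam (fun _ s => M.P s.val)] at h3
    have h4 := mul_le_mul_of_nonneg_left hN1.le hlam
    change lam * meanCost γ q₀ (fun _ s => M.P s.val) N ≤ _ at h4
    linarith
  refine le_of_forall_pos_le_add fun δ hδ => ?_
  -- Division by `lam + 1` covers the case `lam = 0`.
  have h1 := key (δ / (lam + 1)) (by positivity)
  have h2 : lam * (δ / (lam + 1)) ≤ δ := by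
    rw [mul_div_assoc', div_le_iff₀ (by positivity)]
    nlinarith
  linarith

/-- A stationary policy that minimizes the Lagrangian and satisfies complementary slackness is
optimal. -/
lemma optimal_of_lagrangian {lam g : ℝ} {w : M.State → ℝ} (hlam : 0 ≤ lam)
    (hw : ∀ q s, M.Feasible q s → g + w q ≤ actionValue 1 lam w q s) {F : M.StationaryPolicy}
    {p Pth : ℝ}
    (hL : ∀ q₀, Tendsto (meanCost F.toPolicy q₀ fun q s => (q.val : ℝ) + lam * M.P s.val) atTop
      (𝓝 g))
    (hP : ∀ q₀, Tendsto (meanCost F.toPolicy q₀ fun _ s => M.P s.val) atTop (𝓝 p))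
    (hp : p ≤ Pth) (hslack : lam * p = lam * Pth) :
    (∃ p d : ℝ, ∀ q₀ : M.State,
      Tendsto (meanPower F.toPolicy q₀) atTop (𝓝 p) ∧
      Tendsto (meanDelay F.toPolicy q₀) atTop (𝓝 d)) ∧
    ∀ q₀ : M.State, IsDelayOptimal Pth q₀ F.toPolicy := by
  set κ := 1 / (M.α * (M.A : ℝ)) with hκ
  have hA : (0 : ℝ) < M.A := by exact_mod_cast M.A_pos
  have hκ0 : 0 < κ := one_div_pos.2 (mul_pos M.α_pos hA)
  have hD : ∀ q₀, Tendsto (meanDelay F.toPolicy q₀) atTop (𝓝 (κ * (g - lam * p))) := by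
    intro q₀
    have h1 := ((hL q₀).sub ((hP q₀).const_mul lam)).const_mul κ
    refine h1.congr fun N => ?_
    rw [meanCost_add, meanCost_const_mul F.toPolicy q₀ lam (fun _ s => M.P s.val),
      add_sub_cancel_right]
    rfl
  refine ⟨⟨p, _, fun q₀ => ⟨hP q₀, hD q₀⟩⟩, fun q₀ => ⟨?_, fun γ hγ => ?_⟩⟩
  · rw [avgPower, (show Tendsto (meanPower F.toPolicy q₀) atTop (𝓝 p) from hP q₀).limsup_eq]
    exact hp
  · rw [avgDelay, (hD q₀).limsup_eq]
    by_contra hlt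
    -- Mean delays eventually below `b` give `g ≤ b / κ + lam * Pth` by weak duality; by slackness
    -- this contradicts `b < κ * (g - lam * p)`.
    obtain ⟨b, hb₁, hb₂⟩ := exists_between (not_le.1 hlt)
    have hbdd : IsBoundedUnder (· ≤ ·) atTop (meanDelay γ q₀) :=
      isBoundedUnder_of ⟨κ * M.Q, fun N => mul_le_mul_of_nonneg_left ((le_abs_self _).trans
        (abs_meanCost_le γ q₀ (c := fun q _ => (q.val : ℝ)) (fun q _ => by
          rw [abs_of_nonneg (Nat.cast_nonneg _)]
          exact_mod_cast Nat.lt_succ_iff.1 q.isLt) N)) hκ0.le⟩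
    have h1 : ∀ᶠ N in atTop, meanDelay γ q₀ N < b := eventually_lt_of_limsup_lt hb₁ hbdd
    have h2 := gain_le_of_avgPower_le hlam hw hγ (b := b / κ) <| by
      filter_upwards [h1] with N hN
      rw [le_div_iff₀ hκ0, mul_comm]
      exact hN.le
    have h3 : κ * (g - lam * p) ≤ b := by
      rw [mul_comm, ← le_div_iff₀ hκ0]
      linarith
    linarith

lemma tendsto_meanCost_mixture {f₀ f₁ : M.State → M.Action} (hf₀ : ∀ q, M.Feasible q (f₀ q))
    (hf₁ : ∀ q, M.Feasible q (f₁ q)) {p : ℝ} (hp₀ : 0 ≤ p) (hp₁ : p ≤ 1)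
    {c : M.State → M.Action → ℝ} {g : ℝ} {w : M.State → ℝ}
    (h : ∀ q, g + w q = (1 - p) * (c q (f₀ q) + nextMean w (q.val - (f₀ q).val)) +
        p * (c q (f₁ q) + nextMean w (q.val - (f₁ q).val))) (q₀ : M.State) :
    Tendsto (meanCost (mixture f₀ f₁ hf₀ hf₁ p hp₀ hp₁).toPolicy q₀ c) atTop (𝓝 g) := by
  refine tendsto_meanCost _ (w := w) (fun q => ?_) q₀
  rw [h, sum_mixture_mul hf₀ hf₁ hp₀ hp₁ q fun s => c q s + nextMean w (q.val - s.val)]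

lemma tendsto_lagrangian_mixture {f₀ f₁ : M.State → M.Action} (hf₀ : ∀ q, M.Feasible q (f₀ q))
    (hf₁ : ∀ q, M.Feasible q (f₁ q)) {p : ℝ} (hp₀ : 0 ≤ p) (hp₁ : p ≤ 1) {lam g : ℝ}
    {w : M.State → ℝ} (h₀ : ∀ q, g + w q = actionValue 1 lam w q (f₀ q))
    (h₁ : ∀ q, g + w q = actionValue 1 lam w q (f₁ q)) (q₀ : M.State) :
    Tendsto (meanCost (mixture f₀ f₁ hf₀ hf₁ p hp₀ hp₁).toPolicy q₀
      fun q s => (q.val : ℝ) + lam * M.P s.val) atTop (𝓝 g) := by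
  refine tendsto_meanCost_mixture hf₀ hf₁ hp₀ hp₁ (w := w) (fun q => ?_) q₀
  have e₀ := h₀ q
  have e₁ := h₁ q
  unfold actionValue at e₀ e₁
  linear_combination (1 - p) * e₀ + p * e₁

/-- For large multipliers, only policies of sufficiently small power can be optimal. -/
lemma multiplier_mul_le {f : M.State → M.Action} (hf : ∀ q, M.Feasible q (f q)) {lam g gP : ℝ}
    {w wP : M.State → ℝ} (hlam : 0 ≤ lam)
    (hw : ∀ q s, M.Feasible q s → g + w q ≤ actionValue 1 lam w q s)
    (hfw : ∀ q, g + w q = actionValue 1 lam w q (f q))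
    (hP : ∀ q, gP + wP q = M.P (f q).val + nextMean wP (q.val - (f q).val))
    {γ : M.Policy} {q₀ : M.State} {Pth : ℝ} (hγ : avgPower γ q₀ ≤ Pth) :
    lam * (gP - Pth) ≤ M.Q := by
  have h1 := gain_le_of_avgPower_le hlam hw hγ (b := M.Q) <| Eventually.of_forall fun N =>
    (le_abs_self _).trans (abs_meanCost_le γ q₀ (fun q _ => by
      rw [abs_of_nonneg (Nat.cast_nonneg _)]
      exact_mod_cast Nat.lt_succ_iff.1 q.isLt) N)
  -- The queue cost is nonnegative, so the Lagrangian gain of `f` is at least its priced power.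
  have h2 : lam * gP - g ≤ 0 := gain_nonpos hf (w := fun q => lam * wP q - w q) fun q => by
    rw [nextMean_sub, nextMean_mul]
    have e₁ := hfw q
    have e₂ := hP q
    unfold actionValue at e₁
    have e₃ : (0 : ℝ) ≤ q.val := Nat.cast_nonneg _
    have e₄ := congrArg (lam * ·) e₂
    linarith
  linarith

/-! ### Construction of the optimal policy -/

/-- An optimal policy of threshold form for the delay minimization under a power constraint. -/
theorem exists_optimal_threshold_policy (M : Model) (Pth : ℝ)
    (hfeas : ∃ (q₀ : M.State) (γ : M.Policy), avgPower γ q₀ ≤ Pth) :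
    ∃ F : M.StationaryPolicy,
      (∃ (θ : M.Action → M.State) (s' : M.Action),
        HasThresholdForm F.f θ s') ∧
      (∃ p d : ℝ, ∀ q₀ : M.State,
        Tendsto (meanPower F.toPolicy q₀) atTop (nhds p) ∧
        Tendsto (meanDelay F.toPolicy q₀) atTop (nhds d)) ∧
      ∀ q₀ : M.State, IsDelayOptimal Pth q₀ F.toPolicy := by
  classical
  obtain ⟨q₁, γ, hγ⟩ := hfeas
  have hpois : ∀ f : M.State → M.Action, IsRegular f → ∃ (g : ℝ) (w : M.State → ℝ),
      ∀ q, g + w q = M.P (f q).val + nextMean w (q.val - (f q).val) :=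
    fun f hf => hf.exists_poisson fun q => M.P (f q).val
  choose! gP wP hP using hpois
  -- For a high policy optimal at `Λ`, this choice gives `Λ * (gP f - Pth) ≥ Q + 1`, against the
  -- bound `Q` of `multiplier_mul_le`. Terms with `gP f = Pth` are zero by convention, and all
  -- others only enlarge `Λ`.
  set Λ := ∑ f : M.State → M.Action, ((M.Q : ℝ) + 1) / |gP f - Pth| with hΛ
  have hterm : ∀ f : M.State → M.Action, 0 ≤ ((M.Q : ℝ) + 1) / |gP f - Pth| := fun f => by
    positivity
  have hΛ0 : 0 ≤ Λ := Finset.sum_nonneg fun f _ => hterm f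
  obtain ⟨f, f', lam, g, w, hf, hf', hlam, hwc, hw, h⟩ :=
    exists_average_crossing (M := M) (fun f => Pth < gP f) hΛ0
  rcases h with ⟨hlow, h0, ht⟩ | ⟨hhigh, hlamΛ, ht⟩ | ⟨hhigh, hlow, ht, ht'⟩
  -- A low policy is optimal at multiplier `0`: slackness is automatic and no randomization is
  -- needed.
  · refine ⟨mixture f' f' hf'.feasible hf'.feasible 0 le_rfl zero_le_one,
      deterministic_hasThresholdForm hf' (fun q s => ?_), optimal_of_lagrangian hlam hw
        (tendsto_lagrangian_mixture _ _ _ _ ht ht) (p := gP f')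
        (tendsto_meanCost_mixture _ _ _ _ (w := wP f') fun q => ?_) (not_lt.1 hlow)
        (by rw [h0, zero_mul, zero_mul])⟩
    · simp [mixture]
    · rw [hP f' hf' q]
      ring
  · exfalso
    have h1 := multiplier_mul_le hf.feasible hlam hw ht (hP f hf) hγ
    have h2 : ((M.Q : ℝ) + 1) / |gP f - Pth| ≤ lam := by
      rw [hlamΛ]
      exact Finset.single_le_sum (f := fun f => ((M.Q : ℝ) + 1) / |gP f - Pth|)
        (fun f _ => hterm f) (Finset.mem_univ f)
    have h3 : 0 < gP f - Pth := sub_pos.2 hhigh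
    rw [abs_of_pos h3, div_le_iff₀ h3] at h2
    linarith
  · obtain ⟨f₀, q', c, hc, hf₀, hf₁, hC₀, hC₁, hne⟩ := exists_adjacent
      (C := fun q s => M.Feasible q s ∧ actionValue 1 lam w q s = g + w q) (fun q s h => h.1)
      (fun q a b c ha hb hab hc => actionValue_succ_le zero_le_one hlam hwc (hw q) ha.1 hb.1
        ha.2 hb.2 hab hc)
      (fun f => Pth < gP f) hf hf' (fun q => ⟨hf.feasible q, (ht q).symm⟩)
      (fun q => ⟨hf'.feasible q, (ht' q).symm⟩) hhigh hlow
    have hoff : ∀ q, q ≠ q' → f₀ q = Function.update f₀ q' c q := fun q hq =>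
      (Function.update_of_ne hq _ _).symm
    obtain ⟨p, v, hp₀, hp₁, hpv⟩ : ∃ (p : ℝ) (v : M.State → ℝ), 0 ≤ p ∧ p ≤ 1 ∧ ∀ q,
        Pth + v q = (1 - p) * (M.P (f₀ q).val + nextMean v (q.val - (f₀ q).val)) +
          p * (M.P (Function.update f₀ q' c q).val +
            nextMean v (q.val - (Function.update f₀ q' c q).val)) := by
      -- Raising one packet may raise or lower the average power. The cheaper neighbour comes first
      -- in `exists_mixture_poisson`, so the weights may have to be swapped.
      by_cases h₀ : Pth < gP f₀
      · have h₁ : gP (Function.update f₀ q' c) ≤ Pth :=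
          not_lt.1 fun h => hne ⟨fun _ => h, fun _ => h₀⟩
        obtain ⟨p, v, hp₀, hp₁, hpv⟩ := exists_mixture_poisson hf₁.feasible hf₀.feasible
          (fun q hq => (hoff q hq).symm) (c := fun _ s => M.P s.val) (hP _ hf₁) (hP _ hf₀)
          (h₁.trans_lt h₀) h₁ h₀.le
        refine ⟨1 - p, v, by linarith, by linarith, fun q => ?_⟩
        rw [hpv]
        ring
      · have h₁ : Pth < gP (Function.update f₀ q' c) := by
          by_contra h
          exact hne ⟨fun h' => absurd h' h₀, fun h' => absurd h' h⟩
        exact exists_mixture_poisson hf₀.feasible hf₁.feasible hoff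
          (c := fun _ s => M.P s.val) (hP _ hf₀) (hP _ hf₁) ((not_lt.1 h₀).trans_lt h₁)
          (not_lt.1 h₀) h₁.le
    refine ⟨mixture f₀ (Function.update f₀ q' c) hf₀.feasible hf₁.feasible p hp₀ hp₁,
      mixture_hasThresholdForm hc hf₀ hf₁ (p := p) (fun q s => ?_),
      optimal_of_lagrangian hlam hw (tendsto_lagrangian_mixture _ _ _ _
        (fun q => (hC₀ q).2.symm) (fun q => (hC₁ q).2.symm)) (p := Pth)
        (tendsto_meanCost_mixture _ _ _ _ hpv) le_rfl rfl⟩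
    simp only [mixture]

end Model
end BufferedScheduling

theorem theorem4 (M : BufferedScheduling.Model) (Pth : ℝ)
    (hfeas : ∃ (q₀ : M.State) (γ : M.Policy), BufferedScheduling.Model.avgPower γ q₀ ≤ Pth) :
    ∃ F : M.StationaryPolicy,
      (∃ (θ : M.Action → M.State) (s' : M.Action),
        BufferedScheduling.Model.HasThresholdForm F.f θ s') ∧
      (∃ p d : ℝ, ∀ q₀ : M.State,
        Filter.Tendsto (BufferedScheduling.Model.meanPower F.toPolicy q₀) Filter.atTop (nhds p) ∧
        Filter.Tendsto (BufferedScheduling.Model.meanDelay F.toPolicy q₀) Filter.atTop (nhds d)) ∧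
      ∀ q₀ : M.State, BufferedScheduling.Model.IsDelayOptimal Pth q₀ F.toPolicy :=
  BufferedScheduling.Model.exists_optimal_threshold_policy M Pth hfeas
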